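/- Let $\Omega\subset\mathbb R^n$, $n\ge 1$, be a bounded open set (for instance a bounded Lipschitz domain in dimension $n=1,2,3$), let $\varrho>0$ and $f_\pm\in L^2(\Omega)$. Let $H^1_0(\Omega)$ be the closure of $C_c^\infty(\Omega)$ in the $H^1$ norm and $H^{-1}(\Omega)$ its dual. For $u\in H^1_0(\Omega)$ let $\Delta u\in H^{-1}(\Omega)$ be given by $\langle\Delta u,v\rangle_\Omega=-\langle\nabla u,\nabla v\rangle_{L^2(\Omega)}$, where $L^2(\Omega)$ is regarded as a subspace of $H^{-1}(\Omega)$, and let $H^1_\Delta(\Omega)=\{u\in H^1_0(\Omega):\Delta u\in L^2(\Omega)\}$. Put \[ K_c=\{u\in H^1_0(\Omega):\ \langle f_-,v\rangle_{L^2(\Omega)}\le\langle\nabla u,\nabla v\rangle_{L^2(\Omega)}\le\langle f_+,v\rangle_{L^2(\Omega)}\ \text{ for all } v\in H^1_0(\Omega),\ v\ge 0\}, \] and let $\overline u\in K_c\cap H^1_\Delta(\Omega)$. Let $u_\varrho\in K_c$ be the solution of the variational inequality \[ \langle u_\varrho,v-u_\varrho\rangle_{L^2(\Omega)}+\varrho\,\langle\nabla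 u_\varrho,\nabla(v-u_\varrho)\rangle_{L^2(\Omega)}\ \ge\ \langle\overline u,v-u_\varrho\rangle_{L^2(\Omega)}\qquad\text{for all } v\in K_c, \] and let $w\in H^1_0(\Omega)$ be the weak solution of $-\Delta w=-\varrho\Delta u_\varrho+u_\varrho-\overline u$ in $\Omega$, $w=0$ on $\partial\Omega$, that is, \[ \langle\nabla w,\nabla v\rangle_{L^2(\Omega)}=\varrho\,\langle\nabla u_\varrho,\nabla v\rangle_{L^2(\Omega)}+\langle u_\varrho-\overline u,v\rangle_{L^2(\Omega)}\qquad\text{for all } v\in H^1_0(\Omega). \] Then $z_\varrho=-\Delta u_\varrho\in L^2(\Omega)$ and $\Delta w\in L^2(\Omega)$. Moreover, with the active sets $A_\pm=\{x\in\Omega: z_\varrho(x)=f_\pm(x)\}$ (defined up to null sets), one has $w(x)=0$ for almost all $x\in\Omega\setminus(A_-\cup A_+)$ and \[ \|\Delta u_\varrho\|_{L^2(\Omega\setminus(A_-\cup A_+))}\le\|\Delta\overline u\|_{L^2(\Omega)}. \] -/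

import Mathlib

open MeasureTheory
open scoped ContDiff RealInnerProductSpace

noncomputable section

namespace EnergyControl

/-- The space `L²(Ω)` of real-valued functions, for `Ω ⊆ ℝⁿ` with Lebesgue measure. -/
abbrev L2 {n : ℕ} (Ω : Set (EuclideanSpace ℝ (Fin n))) : Type :=
  Lp ℝ 2 (volume.restrict Ω)

/-- The space `L²(Ω)ⁿ` of vector fields. -/
abbrev L2Vec {n : ℕ} (Ω : Set (EuclideanSpace ℝ (Fin n))) : Type :=
  Lp (EuclideanSpace ℝ (Fin n)) 2 (volume.restrict Ω)

/-- Test functions `φ ∈ C_c^∞(Ω)`. -/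
structure IsTestFunction {n : ℕ} (Ω : Set (EuclideanSpace ℝ (Fin n)))
    (φ : EuclideanSpace ℝ (Fin n) → ℝ) : Prop where
  smooth : ContDiff ℝ ∞ φ
  compact : HasCompactSupport φ
  subset : tsupport φ ⊆ Ω

/-- The subspace of `L²(Ω) × L²(Ω)ⁿ` that consists of all pairs `(φ, ∇φ)`, `φ ∈ C_c^∞(Ω)`. -/
def testPairs {n : ℕ} (Ω : Set (EuclideanSpace ℝ (Fin n))) :
    Submodule ℝ (WithLp 2 (L2 Ω × L2Vec Ω)) where
  carrier := {p | ∃ φ : EuclideanSpace ℝ (Fin n) → ℝ, IsTestFunction Ω φ ∧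
    p.fst =ᵐ[volume.restrict Ω] φ ∧ p.snd =ᵐ[volume.restrict Ω] gradient φ}
  zero_mem' := by
    refine ⟨fun _ => 0, ⟨contDiff_const, ?_, ?_⟩, ?_, ?_⟩
    · exact HasCompactSupport.zero
    · have h : tsupport (fun _ : EuclideanSpace ℝ (Fin n) => (0 : ℝ)) = ∅ :=
        tsupport_eq_empty_iff.mpr rfl
      rw [h]
      exact Set.empty_subset _
    · exact Lp.coeFn_zero _ _ _
    · filter_upwards [Lp.coeFn_zero (EuclideanSpace ℝ (Fin n)) 2 (volume.restrict Ω)] with x hx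
      have h : gradient (fun _ : EuclideanSpace ℝ (Fin n) => (0 : ℝ)) x = 0 := by
        simp [gradient]
      rw [h]
      exact hx
  add_mem' := by
    rintro p q ⟨φ, hφ, hp1, hp2⟩ ⟨ψ, hψ, hq1, hq2⟩
    refine ⟨φ + ψ, ⟨hφ.smooth.add hψ.smooth, hφ.compact.add hψ.compact, ?_⟩, ?_, ?_⟩
    · exact (tsupport_add φ ψ).trans (Set.union_subset hφ.subset hψ.subset)
    · filter_upwards [Lp.coeFn_add p.fst q.fst, hp1, hq1] with x h h1 h2
      rw [WithLp.add_fst, h, Pi.add_apply, Pi.add_apply, h1, h2]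
    · filter_upwards [Lp.coeFn_add p.snd q.snd, hp2, hq2] with x h h1 h2
      have hd1 : DifferentiableAt ℝ φ x := (hφ.smooth.differentiable (by simp)) x
      have hd2 : DifferentiableAt ℝ ψ x := (hψ.smooth.differentiable (by simp)) x
      rw [WithLp.add_snd, h, Pi.add_apply, h1, h2]
      simp only [gradient]
      rw [fderiv_add hd1 hd2, map_add]
  smul_mem' := by
    rintro c p ⟨φ, hφ, hp1, hp2⟩
    refine ⟨c • φ, ⟨hφ.smooth.const_smul c, hφ.compact.smul_left, ?_⟩, ?_, ?_⟩
    · exact (closure_mono (Function.support_const_smul_subset c φ)).trans hφ.subset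
    · filter_upwards [Lp.coeFn_smul c p.fst, hp1] with x h h1
      rw [WithLp.smul_fst, h, Pi.smul_apply, Pi.smul_apply, h1]
    · filter_upwards [Lp.coeFn_smul c p.snd, hp2] with x h h1
      have hd1 : DifferentiableAt ℝ φ x := (hφ.smooth.differentiable (by simp)) x
      rw [WithLp.smul_snd, h, Pi.smul_apply, h1]
      simp only [gradient]
      rw [fderiv_const_smul hd1, map_smul]

/-- The Sobolev space `H¹₀(Ω)`, the closure of `C_c^∞(Ω)` in the `H¹` norm
`(‖u‖² + ‖∇u‖²)^{1/2}`. An element is stored as the pair `(u, ∇u)` of the function and its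
weak gradient. -/
abbrev H10 {n : ℕ} (Ω : Set (EuclideanSpace ℝ (Fin n))) :
    Submodule ℝ (WithLp 2 (L2 Ω × L2Vec Ω)) :=
  (testPairs Ω).topologicalClosure

/-- The embedding of `H¹₀(Ω)` into `L²(Ω)`. -/
def toL2 {n : ℕ} (Ω : Set (EuclideanSpace ℝ (Fin n))) : H10 Ω →L[ℝ] L2 Ω :=
  (WithLp.fstL 2 ℝ (L2 Ω) (L2Vec Ω)).comp (H10 Ω).subtypeL

/-- The weak gradient `H¹₀(Ω) → L²(Ω)ⁿ`. -/
def grad {n : ℕ} (Ω : Set (EuclideanSpace ℝ (Fin n))) : H10 Ω →L[ℝ] L2Vec Ω :=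
  (WithLp.sndL 2 ℝ (L2 Ω) (L2Vec Ω)).comp (H10 Ω).subtypeL

/-- The space `H⁻¹(Ω)`, the dual of `H¹₀(Ω)`. -/
abbrev Hneg1 {n : ℕ} (Ω : Set (EuclideanSpace ℝ (Fin n))) : Type :=
  StrongDual ℝ (H10 Ω)

/-- The embedding of `L²(Ω)` into `H⁻¹(Ω)`, `f ↦ ⟨f, ·⟩_{L²(Ω)}`. -/
def ofL2 {n : ℕ} (Ω : Set (EuclideanSpace ℝ (Fin n))) (f : L2 Ω) : Hneg1 Ω :=
  (innerSL ℝ f).comp (toL2 Ω)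

/-- The weak Laplacian `Δ : H¹₀(Ω) → H⁻¹(Ω)`, `⟨Δu, v⟩_Ω = -⟨∇u, ∇v⟩_{L²(Ω)}`. -/
def laplacian {n : ℕ} (Ω : Set (EuclideanSpace ℝ (Fin n))) (u : H10 Ω) : Hneg1 Ω :=
  -(innerSL ℝ (grad Ω u)).comp (grad Ω)

/-- The space `H¹_Δ(Ω)` of all `u ∈ H¹₀(Ω)` with `Δu ∈ L²(Ω)`. -/
def H1Delta {n : ℕ} (Ω : Set (EuclideanSpace ℝ (Fin n))) : Set (H10 Ω) :=
  {u | ∃ q : L2 Ω, laplacian Ω u = ofL2 Ω q}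

/-- The set `K_c` of all states that satisfy the control constraints `f₋ ≤ -Δu ≤ f₊` in the
weak form. -/
def Kc {n : ℕ} (Ω : Set (EuclideanSpace ℝ (Fin n))) (fm fp : L2 Ω) : Set (H10 Ω) :=
  {u | ∀ v : H10 Ω, (∀ᵐ x ∂(volume.restrict Ω), 0 ≤ toL2 Ω v x) →
    ⟪fm, toL2 Ω v⟫ ≤ ⟪grad Ω u, grad Ω v⟫ ∧ ⟪grad Ω u, grad Ω v⟫ ≤ ⟪fp, toL2 Ω v⟫}

/-- `u ∈ K_c` solves the variational inequality
`⟨u, v - u⟩ + ρ ⟨∇u, ∇(v - u)⟩ ≥ ⟨ubar, v - u⟩` for all `v ∈ K_c`. -/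
def SolvesVI {n : ℕ} (Ω : Set (EuclideanSpace ℝ (Fin n))) (fm fp : L2 Ω) (ρ : ℝ)
    (ubar : L2 Ω) (u : H10 Ω) : Prop :=
  u ∈ Kc Ω fm fp ∧ ∀ v ∈ Kc Ω fm fp,
    ⟪ubar, toL2 Ω (v - u)⟫ ≤
      ⟪toL2 Ω u, toL2 Ω (v - u)⟫ + ρ * ⟪grad Ω u, grad Ω (v - u)⟫

/-- `w ∈ H¹₀(Ω)` is the weak solution of `-Δw = -ρ Δu + u - ubar` in `Ω`, `w = 0` on `∂Ω`. -/
def SolvesAdjoint {n : ℕ} (Ω : Set (EuclideanSpace ℝ (Fin n))) (ρ : ℝ)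
    (ubar : L2 Ω) (u w : H10 Ω) : Prop :=
  ∀ v : H10 Ω, ⟪grad Ω w, grad Ω v⟫ =
    ρ * ⟪grad Ω u, grad Ω v⟫ + ⟪toL2 Ω u - ubar, toL2 Ω v⟫

/-- The set of points of `Ω` at which the control `z` equals the bound `f`. -/
def activeSet {n : ℕ} (Ω : Set (EuclideanSpace ℝ (Fin n))) (z f : L2 Ω) :
    Set (EuclideanSpace ℝ (Fin n)) :=
  {x | x ∈ Ω ∧ z x = f x}

end EnergyControl

end

/-! ### The resolvent of the Laplacian on Schwartz functions and its L² bounds -/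

section Schwartz

open SchwartzMap FourierTransform Laplacian LineDeriv Filter Topology

variable {E : Type*} [NormedAddCommGroup E] [InnerProductSpace ℝ E]

/-! For `u ∈ K_c` the functional `v ↦ ⟨∇u, ∇v⟩ - ⟨f₋, v⟩` is positive and dominated by `⟨f₊ - f₋,
v⟩` for `v ≥ 0`. It is therefore bounded in the L² norm, and Riesz gives `z = -Δu ∈ L²`
(`exists_eq_inner_of_mem_Kc`). By Poincaré and Lax–Milgram every L² control is some `-Δv`, so the
variational inequality becomes `⟨y - z, w⟩ ≥ 0` for all `f₋ ≤ y ≤ f₊`. Pointwise variations of `y`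
force `w = 0` off the active sets.

There `Δw = 0` as well (`ae_laplacian_eq_zero`), so the adjoint equation reads `ρ z = ubar - u`.
Testing the variational inequality with `ubar` gives `‖ubar - u‖ ≤ ρ ‖Δubar‖`, which is the
estimate.

The analytic core is that `Δw` vanishes a.e. on `{w = 0}`. Cutoffs reduce it to the whole space,
where the resolvent gives L² approximation together with first and pure second derivatives. A weak
derivative vanishes a.e. on the zero set of its function, and this is applied once to the function
and once to its derivatives. -/

theorem norm_inner_mul_resolvent_le (x m : E) :
    |inner ℝ x m * (1 + ‖x‖ ^ 2) ^ (-1 : ℝ)| ≤ ‖m‖ := by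
  rw [abs_mul, Real.rpow_neg_one, abs_inv, abs_of_pos (by positivity : 0 < 1 + ‖x‖ ^ 2),
    ← div_eq_mul_inv, div_le_iff₀ (by positivity)]
  nlinarith [abs_real_inner_le_norm x m, norm_nonneg m, norm_nonneg x, sq_nonneg (‖x‖ - 1),
    mul_nonneg (norm_nonneg m) (sq_nonneg (‖x‖ - 1)), mul_nonneg (norm_nonneg m) (sq_nonneg ‖x‖)]

/-- The symbol of `∂_m` is `2πi⟨x, m⟩`, so this bound keeps two derivatives of the resolvent bounded
on L². It is Cauchy–Schwarz with `‖x‖² ≤ 1 + ‖x‖²`. -/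
theorem norm_inner_sq_mul_resolvent_le (x m : E) :
    |inner ℝ x m * (inner ℝ x m * (1 + ‖x‖ ^ 2) ^ (-1 : ℝ))| ≤ ‖m‖ ^ 2 := by
  rw [← mul_assoc, abs_mul, Real.rpow_neg_one, abs_inv,
    abs_of_pos (by positivity : 0 < 1 + ‖x‖ ^ 2),
    ← div_eq_mul_inv, div_le_iff₀ (by positivity), abs_mul]
  have h := abs_real_inner_le_norm x m
  nlinarith [mul_le_mul h h (abs_nonneg _) (by positivity), sq_nonneg ‖m‖]

theorem hasTemperateGrowth_resolvent :
    (fun x : E ↦ (1 + ‖x‖ ^ 2) ^ (-1 : ℝ)).HasTemperateGrowth :=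
  Function.hasTemperateGrowth_one_add_norm_sq_rpow E (-1)

theorem postcompCLM_lineDerivOp {F G : Type*} [NormedAddCommGroup F] [NormedSpace ℝ F]
    [NormedAddCommGroup G] [NormedSpace ℝ G] (T : F →L[ℝ] G) (f : 𝓢(E, F)) (m : E) :
    ∂_{m} (f.postcompCLM T) = (∂_{m} f).postcompCLM T := by
  ext x
  rw [lineDerivOp_apply_eq_fderiv, postcompCLM_apply, lineDerivOp_apply_eq_fderiv]
  have h : (f.postcompCLM T : E → G) = T ∘ f := rfl
  rw [h, fderiv_comp x T.differentiableAt f.differentiableAt, T.fderiv]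
  rfl

variable [FiniteDimensional ℝ E] [MeasurableSpace E] [BorelSpace E]

/-- Plancherel: on the Fourier side the operator is pointwise multiplication by `g`. -/
theorem SchwartzMap.norm_toLp_fourierMultiplierCLM_le {g : E → ℝ} (hg : g.HasTemperateGrowth)
    {C : ℝ} (hC : ∀ x, |g x| ≤ C) (f : 𝓢(E, ℂ)) :
    ‖(fourierMultiplierCLM ℂ g f).toLp 2‖ ≤ C * ‖f.toLp 2‖ := by
  rw [← norm_fourier_toL2_eq, fourierMultiplierCLM_apply, fourier_fourierInv_eq,
    ← norm_fourier_toL2_eq f]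
  refine Lp.norm_le_mul_norm_of_ae_le_mul ?_
  filter_upwards [(smulLeftCLM ℂ g (𝓕 f)).coeFn_toLp 2, (𝓕 f).coeFn_toLp 2] with x h1 h2
  rw [h1, h2, smulLeftCLM_apply_apply hg, norm_smul]
  exact mul_le_mul_of_nonneg_right (hC x) (norm_nonneg _)

/-- The operator `(1 - (2π)⁻² Δ)⁻¹` on real-valued Schwartz functions. -/
noncomputable def schwartzResolvent : 𝓢(E, ℝ) →ₗ[ℝ] 𝓢(E, ℝ) :=
  -- The multiplier acts on complex functions. Taking the real part afterwards commutes with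
  -- derivatives and does not increase the L² norm.
  (postcompCLM Complex.reCLM).toLinearMap ∘ₗ
    (fourierMultiplierCLM ℂ (fun x : E ↦ (1 + ‖x‖ ^ 2) ^ (-1 : ℝ))).toLinearMap ∘ₗ
      (postcompCLM Complex.ofRealCLM).toLinearMap

theorem norm_toLp_postcomp_re_le (f : 𝓢(E, ℂ)) :
    ‖(f.postcompCLM Complex.reCLM).toLp 2‖ ≤ ‖f.toLp 2‖ := by
  refine Lp.norm_le_norm_of_ae_le ?_
  filter_upwards [(f.postcompCLM Complex.reCLM).coeFn_toLp 2, f.coeFn_toLp 2] with x h1 h2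
  rw [h1, h2]
  exact Complex.abs_re_le_norm _

theorem norm_toLp_postcomp_ofReal (f : 𝓢(E, ℝ)) :
    ‖(f.postcompCLM Complex.ofRealCLM).toLp 2‖ = ‖f.toLp 2‖ := by
  rw [norm_toLp, norm_toLp]
  congr 1
  refine eLpNorm_congr_norm_ae (ae_of_all _ fun x ↦ ?_)
  simp

theorem norm_schwartzResolvent_le (f : 𝓢(E, ℝ)) :
    ‖(schwartzResolvent f).toLp 2‖ ≤ ‖f.toLp 2‖ := by
  refine (norm_toLp_postcomp_re_le _).trans ?_
  rw [← norm_toLp_postcomp_ofReal f]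
  refine le_of_le_of_eq ?_ (one_mul _)
  refine norm_toLp_fourierMultiplierCLM_le hasTemperateGrowth_resolvent (fun x ↦ ?_) _
  rw [Real.rpow_neg_one, abs_of_nonneg (by positivity)]
  exact inv_le_one_of_one_le₀ (by nlinarith [sq_nonneg ‖x‖])

theorem lineDerivOp_schwartzResolvent (f : 𝓢(E, ℝ)) (m : E) :
    ∂_{m} (schwartzResolvent f) = postcompCLM Complex.reCLM ((2 * (Real.pi : ℂ) * Complex.I) •
      fourierMultiplierCLM ℂ (fun x : E ↦ inner ℝ x m * (1 + ‖x‖ ^ 2) ^ (-1 : ℝ))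
        (postcompCLM Complex.ofRealCLM f)) := by
  change ∂_{m} (postcompCLM Complex.reCLM (fourierMultiplierCLM ℂ
    (fun x : E ↦ (1 + ‖x‖ ^ 2) ^ (-1 : ℝ)) (postcompCLM Complex.ofRealCLM f))) = _
  rw [postcompCLM_lineDerivOp, lineDeriv_eq_fourierMultiplierCLM,
    fourierMultiplierCLM_fourierMultiplierCLM_apply (by fun_prop) hasTemperateGrowth_resolvent]
  rfl

theorem lineDerivOp_lineDerivOp_schwartzResolvent (f : 𝓢(E, ℝ)) (m : E) :
    ∂_{m} (∂_{m} (schwartzResolvent f)) =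
      postcompCLM Complex.reCLM ((2 * (Real.pi : ℂ) * Complex.I) • (2 * (Real.pi : ℂ) * Complex.I) •
      fourierMultiplierCLM ℂ
        (fun x : E ↦ inner ℝ x m * (inner ℝ x m * (1 + ‖x‖ ^ 2) ^ (-1 : ℝ)))
        (postcompCLM Complex.ofRealCLM f)) := by
  rw [lineDerivOp_schwartzResolvent, postcompCLM_lineDerivOp, LineDeriv.lineDerivOp_smul,
    lineDeriv_eq_fourierMultiplierCLM,
    fourierMultiplierCLM_fourierMultiplierCLM_apply (by fun_prop)
      (by have := hasTemperateGrowth_resolvent (E := E); fun_prop)]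
  rfl

theorem norm_toLp_smul_complex (c : ℂ) (f : 𝓢(E, ℂ)) :
    ‖(c • f).toLp 2‖ = ‖c‖ * ‖f.toLp 2‖ := by
  rw [← toLpCLM_apply (𝕜 := ℂ), map_smul, norm_smul, toLpCLM_apply]

theorem norm_two_pi_I : ‖(2 * (Real.pi : ℂ) * Complex.I : ℂ)‖ = 2 * Real.pi := by
  simp [abs_of_pos Real.pi_pos]

theorem norm_lineDerivOp_schwartzResolvent_le (f : 𝓢(E, ℝ)) (m : E) :
    ‖(∂_{m} (schwartzResolvent f)).toLp 2‖ ≤ 2 * Real.pi * ‖m‖ * ‖f.toLp 2‖ := by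
  rw [lineDerivOp_schwartzResolvent]
  refine (norm_toLp_postcomp_re_le _).trans ?_
  rw [norm_toLp_smul_complex, norm_two_pi_I, ← norm_toLp_postcomp_ofReal f,
    mul_assoc (2 * Real.pi)]
  refine mul_le_mul_of_nonneg_left ?_ (by positivity)
  refine norm_toLp_fourierMultiplierCLM_le ?_ (fun x ↦ norm_inner_mul_resolvent_le x m) _
  have := hasTemperateGrowth_resolvent (E := E)
  fun_prop

theorem norm_lineDerivOp_lineDerivOp_schwartzResolvent_le (f : 𝓢(E, ℝ)) (m : E) :
    ‖(∂_{m} (∂_{m} (schwartzResolvent f))).toLp 2‖ ≤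
      (2 * Real.pi) ^ 2 * ‖m‖ ^ 2 * ‖f.toLp 2‖ := by
  rw [lineDerivOp_lineDerivOp_schwartzResolvent]
  refine (norm_toLp_postcomp_re_le _).trans ?_
  rw [norm_toLp_smul_complex, norm_toLp_smul_complex, norm_two_pi_I,
    ← norm_toLp_postcomp_ofReal f, ← mul_assoc, ← sq, mul_assoc]
  refine mul_le_mul_of_nonneg_left ?_ (by positivity)
  refine norm_toLp_fourierMultiplierCLM_le ?_ (fun x ↦ norm_inner_sq_mul_resolvent_le x m) _
  have := hasTemperateGrowth_resolvent (E := E)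
  fun_prop

theorem laplacian_schwartzResolvent (f : 𝓢(E, ℝ)) :
    Δ (schwartzResolvent f) = (2 * Real.pi) ^ 2 • (schwartzResolvent f - f) := by
  set A := fourierMultiplierCLM ℂ (fun x : E ↦ (1 + ‖x‖ ^ 2) ^ (-1 : ℝ)) with hA
  set fc := postcompCLM Complex.ofRealCLM f with hfc
  have h1 : Δ (schwartzResolvent f) = postcompCLM Complex.reCLM (Δ (A fc)) := by
    have e : schwartzResolvent f = postcompCLM Complex.reCLM (A fc) := rfl
    rw [e, SchwartzMap.laplacian_eq_sum (stdOrthonormalBasis ℝ E),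
      SchwartzMap.laplacian_eq_sum (stdOrthonormalBasis ℝ E), map_sum]
    simp only [postcompCLM_lineDerivOp]
  have h2 : Δ (A fc) = (2 * Real.pi) ^ 2 • (A fc - fc) := by
    rw [laplacian_eq_fourierMultiplierCLM, hA,
      fourierMultiplierCLM_fourierMultiplierCLM_apply (by fun_prop) hasTemperateGrowth_resolvent]
    -- On symbols the resolvent equation is `s/(1+s) = 1 - 1/(1+s)` with `s = ‖x‖²`.
    have e : ((fun x : E ↦ ‖x‖ ^ 2) * fun x : E ↦ (1 + ‖x‖ ^ 2) ^ (-1 : ℝ)) =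
        (fun _ ↦ (1 : ℝ)) - fun x : E ↦ (1 + ‖x‖ ^ 2) ^ (-1 : ℝ) := by
      ext x
      simp only [Pi.mul_apply, Pi.sub_apply, Real.rpow_neg_one]
      field_simp
      ring
    have e' : fourierMultiplierCLM ℂ ((fun _ ↦ (1 : ℝ)) -
        fun x : E ↦ (1 + ‖x‖ ^ 2) ^ (-1 : ℝ)) fc = fc - A fc := by
      change fourierInvCLM ℝ 𝓢(E, ℂ) (smulLeftCLM ℂ _ (fourierCLM ℝ 𝓢(E, ℂ) fc)) = _
      rw [smulLeftCLM_sub (by fun_prop) hasTemperateGrowth_resolvent, _root_.sub_apply, map_sub]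
      congr 1
      simp
    rw [e, e']
    module
  rw [h1, h2]
  ext x
  simp only [postcompCLM_apply, smul_apply, _root_.sub_apply, smul_eq_mul]
  rw [Complex.reCLM_apply, Complex.smul_re]
  rfl

end Schwartz

/-! ### A weak derivative vanishes almost everywhere on the zero set -/

section LevelSets

open SchwartzMap Laplacian LineDeriv Filter Topology

theorem L2.integrable_abs_mul_abs {α : Type*} [MeasurableSpace α] {μ : Measure α}
    (f g : Lp ℝ 2 μ) : Integrable (fun x ↦ |f x| * |g x|) μ := by
  refine (L2.integrable_inner (𝕜 := ℝ) |f| |g|).congr ?_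
  filter_upwards [Lp.coeFn_abs f, Lp.coeFn_abs g] with x h1 h2
  rw [h1, h2]
  simp [mul_comm]

theorem L2.integral_abs_mul_abs_le {α : Type*} [MeasurableSpace α] {μ : Measure α}
    (f g : Lp ℝ 2 μ) : ∫ x, |f x| * |g x| ∂μ ≤ ‖f‖ * ‖g‖ := by
  rw [← norm_abs_eq_norm f, ← norm_abs_eq_norm g]
  refine le_of_eq_of_le ?_ (real_inner_le_norm |f| |g|)
  rw [L2.inner_def]
  refine integral_congr_ae ?_
  filter_upwards [Lp.coeFn_abs f, Lp.coeFn_abs g] with x h1 h2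
  rw [h1, h2]
  simp [mul_comm]

/-- For `a > 0` the function `arctan(a t)/a` is a smooth truncation of size at most `π/(2a)`. As `a
→ ∞` its derivative decreases to the indicator of `{0}`, which isolates the zero set. -/
theorem hasDerivAt_arctan_mul_div {a : ℝ} (ha : a ≠ 0) (t : ℝ) :
    HasDerivAt (fun t ↦ Real.arctan (a * t) / a) (1 + (a * t) ^ 2)⁻¹ t := by
  have h := ((((hasDerivAt_id t).const_mul a).arctan).div_const a)
  refine h.congr_deriv ?_
  simp only [id]
  field_simp

theorem abs_inv_one_add_sq_sub_le (s t : ℝ) :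
    |(1 + s ^ 2)⁻¹ - (1 + t ^ 2)⁻¹| ≤ |s - t| := by
  have h : (1 + s ^ 2)⁻¹ - (1 + t ^ 2)⁻¹ = (t - s) * ((t + s) / ((1 + s ^ 2) * (1 + t ^ 2))) := by
    field_simp
    ring
  rw [h, abs_mul, abs_sub_comm]
  refine mul_le_of_le_one_right (abs_nonneg _) ?_
  rw [abs_div, abs_of_pos (by positivity : 0 < (1 + s ^ 2) * (1 + t ^ 2)),
    div_le_one (by positivity), abs_le]
  constructor <;> nlinarith [sq_nonneg (s + 1), sq_nonneg (t + 1), sq_nonneg (s - 1),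
    sq_nonneg (t - 1), mul_nonneg (sq_nonneg s) (sq_nonneg t)]

theorem abs_arctan_mul_div_sub_le {a : ℝ} (ha : 0 < a) (s t : ℝ) :
    |Real.arctan (a * s) / a - Real.arctan (a * t) / a| ≤ |s - t| := by
  have h := Convex.norm_image_sub_le_of_norm_hasDerivWithin_le (s := Set.univ) (C := 1)
    (f := fun t ↦ Real.arctan (a * t) / a) (f' := fun t ↦ (1 + (a * t) ^ 2)⁻¹)
    (fun x _ ↦ (hasDerivAt_arctan_mul_div ha.ne' x).hasDerivWithinAt) (fun x _ ↦ ?_)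
    convex_univ (Set.mem_univ t) (Set.mem_univ s)
  · simpa using h
  · rw [Real.norm_of_nonneg (by positivity)]
    exact inv_le_one_of_one_le₀ (by nlinarith [sq_nonneg (a * x)])

variable {E : Type*} [NormedAddCommGroup E] [InnerProductSpace ℝ E] [FiniteDimensional ℝ E]
  [MeasurableSpace E] [BorelSpace E]

theorem continuous_arctan_mul_div (a : ℝ) : Continuous fun t : ℝ ↦ Real.arctan (a * t) / a := by
  fun_prop

theorem continuous_inv_one_add_sq (a : ℝ) : Continuous fun t : ℝ ↦ (1 + (a * t) ^ 2)⁻¹ := by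
  refine Continuous.inv₀ (by fun_prop) (fun t ↦ by positivity)

theorem abs_inv_one_add_sq_le (t : ℝ) : |(1 + t ^ 2)⁻¹| ≤ 1 := by
  rw [abs_of_nonneg (by positivity)]
  exact inv_le_one_of_one_le₀ (by nlinarith [sq_nonneg t])

theorem SchwartzMap.integral_arctan_comp_mul_lineDerivOp (p η : 𝓢(E, ℝ)) (m : E) {a : ℝ}
    (ha : 0 < a) :
    Integrable (fun x ↦ Real.arctan (a * p x) / a * ∂_{m} η x) volume ∧
    Integrable (fun x ↦ (1 + (a * p x) ^ 2)⁻¹ * ∂_{m} p x * η x) volume ∧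
    ∫ x, Real.arctan (a * p x) / a * ∂_{m} η x =
      -∫ x, (1 + (a * p x) ^ 2)⁻¹ * ∂_{m} p x * η x := by
  have hb : ∀ t : ℝ, |Real.arctan (a * t) / a| ≤ |t| := fun t ↦ by
    simpa using abs_arctan_mul_div_sub_le ha t 0
  have hmul : ∀ f g : 𝓢(E, ℝ), Integrable (fun x ↦ f x * g x) := fun f g ↦
    (f.memLp 2).integrable_mul (g.memLp 2)
  have hfd : ∀ x, HasFDerivAt (fun x ↦ Real.arctan (a * p x) / a)
      ((1 + (a * p x) ^ 2)⁻¹ • fderiv ℝ p x) x := fun x ↦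
    (hasDerivAt_arctan_mul_div ha.ne' (p x)).comp_hasFDerivAt x p.differentiableAt.hasFDerivAt
  have i1 : Integrable (fun x ↦ Real.arctan (a * p x) / a * ∂_{m} η x) := by
    refine (hmul p (∂_{m} η)).mono
      (((continuous_arctan_mul_div a).comp p.continuous).mul
        (∂_{m} η).continuous).aestronglyMeasurable (ae_of_all _ fun x ↦ ?_)
    rw [norm_mul, norm_mul]
    exact mul_le_mul_of_nonneg_right (hb _) (norm_nonneg _)
  have i2 : Integrable (fun x ↦ (1 + (a * p x) ^ 2)⁻¹ * ∂_{m} p x * η x) := by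
    refine (hmul (∂_{m} p) η).mono
      ((((continuous_inv_one_add_sq a).comp p.continuous).mul
        (∂_{m} p).continuous).mul η.continuous).aestronglyMeasurable (ae_of_all _ fun x ↦ ?_)
    rw [norm_mul, norm_mul, norm_mul]
    exact mul_le_mul_of_nonneg_right (mul_le_of_le_one_left (norm_nonneg _)
      (abs_inv_one_add_sq_le _)) (norm_nonneg _)
  have i3 : Integrable (fun x ↦ Real.arctan (a * p x) / a * η x) := by
    refine (hmul p η).mono
      (((continuous_arctan_mul_div a).comp p.continuous).mul
        η.continuous).aestronglyMeasurable (ae_of_all _ fun x ↦ ?_)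
    rw [norm_mul, norm_mul]
    exact mul_le_mul_of_nonneg_right (hb _) (norm_nonneg _)
  refine ⟨i1, i2, ?_⟩
  exact integral_bilinear_hasFDerivAt_right_eq_neg_left_of_integrable
    (B := ContinuousLinearMap.mul ℝ ℝ) (v := m) i2 i1 i3 (fun x _ ↦ hfd x)
    (fun x _ ↦ η.differentiableAt.hasFDerivAt)

theorem tendsto_mul_add_mul_add_mul {s t : ℕ → ℝ} (hs : Tendsto s atTop (𝓝 0))
    (ht : Tendsto t atTop (𝓝 0)) (a b c d : ℝ) :
    Tendsto (fun k ↦ s k * a + t k * b + c * (s k * d)) atTop (𝓝 0) := by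
  simpa using ((hs.mul_const a).add (ht.mul_const b)).add ((hs.mul_const d).const_mul c)

/-- The chain rule passes to L² limits because the truncation is 1-Lipschitz and its derivative is
bounded by 1 and `a`-Lipschitz. -/
theorem integral_arctan_comp_mul_lineDerivOp_of_tendsto {p : ℕ → 𝓢(E, ℝ)} {m : E}
    {v G : Lp ℝ 2 (volume : Measure E)}
    (hv : Tendsto (fun k ↦ (p k).toLp 2 volume) atTop (𝓝 v))
    (hG : Tendsto (fun k ↦ (∂_{m} (p k)).toLp 2 volume) atTop (𝓝 G)) (η : 𝓢(E, ℝ)) {a : ℝ}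
    (ha : 0 < a) :
    Integrable (fun x ↦ Real.arctan (a * v x) / a * ∂_{m} η x) volume ∧
    Integrable (fun x ↦ (1 + (a * v x) ^ 2)⁻¹ * G x * η x) volume ∧
    ∫ x, Real.arctan (a * v x) / a * ∂_{m} η x = -∫ x, (1 + (a * v x) ^ 2)⁻¹ * G x * η x := by
  have hb : ∀ t : ℝ, |Real.arctan (a * t) / a| ≤ |t| := fun t ↦ by
    simpa using abs_arctan_mul_div_sub_le ha t 0
  have hvm := (Lp.aestronglyMeasurable v)
  have i1 : Integrable (fun x ↦ Real.arctan (a * v x) / a * ∂_{m} η x) := by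
    refine ((Lp.memLp v).integrable_mul ((∂_{m} η).memLp 2)).mono
      (((continuous_arctan_mul_div a).comp_aestronglyMeasurable hvm).mul
        (∂_{m} η).continuous.aestronglyMeasurable) (ae_of_all _ fun x ↦ ?_)
    rw [norm_mul, Pi.mul_apply, norm_mul]
    exact mul_le_mul_of_nonneg_right (hb _) (norm_nonneg _)
  have i2 : Integrable (fun x ↦ (1 + (a * v x) ^ 2)⁻¹ * G x * η x) := by
    refine ((Lp.memLp G).integrable_mul (η.memLp 2)).mono
      ((((continuous_inv_one_add_sq a).comp_aestronglyMeasurable hvm).mul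
        (Lp.aestronglyMeasurable G)).mul η.continuous.aestronglyMeasurable)
        (ae_of_all _ fun x ↦ ?_)
    rw [norm_mul, norm_mul, Pi.mul_apply, norm_mul]
    exact mul_le_mul_of_nonneg_right (mul_le_of_le_one_left (norm_nonneg _)
      (abs_inv_one_add_sq_le _)) (norm_nonneg _)
  refine ⟨i1, i2, ?_⟩
  obtain ⟨B, hB0, hB⟩ := η.decay 0 0
  replace hB : ∀ x, |η x| ≤ B := fun x ↦ by simpa using hB x
  rw [← sub_eq_zero, sub_neg_eq_add, ← integral_add i1 i2, ← norm_le_zero_iff]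
  have hlim := tendsto_mul_add_mul_add_mul (tendsto_iff_norm_sub_tendsto_zero.mp hv)
    (tendsto_iff_norm_sub_tendsto_zero.mp hG) ‖(∂_{m} η).toLp 2 volume‖ ‖η.toLp 2 volume‖
    (a * B) ‖G‖
  refine ge_of_tendsto hlim (Eventually.of_forall fun k ↦ ?_)
  obtain ⟨j1, j2, hj⟩ := (p k).integral_arctan_comp_mul_lineDerivOp η m ha
  have hz : ∫ x, (Real.arctan (a * p k x) / a * ∂_{m} η x +
      (1 + (a * p k x) ^ 2)⁻¹ * ∂_{m} (p k) x * η x) = 0 := by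
    rw [integral_add j1 j2, hj, neg_add_cancel]
  have i12 : Integrable (fun x ↦ Real.arctan (a * v x) / a * ∂_{m} η x +
      (1 + (a * v x) ^ 2)⁻¹ * G x * η x) := i1.add i2
  have j12 : Integrable (fun x ↦ Real.arctan (a * p k x) / a * ∂_{m} η x +
      (1 + (a * p k x) ^ 2)⁻¹ * ∂_{m} (p k) x * η x) := j1.add j2
  rw [← sub_zero (∫ x, _), ← hz, ← integral_sub i12 j12]
  set V := (p k).toLp 2 volume - v with hV
  set W := (∂_{m} (p k)).toLp 2 volume - G with hW
  have e1 := L2.integrable_abs_mul_abs V ((∂_{m} η).toLp 2 volume)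
  have e2 := L2.integrable_abs_mul_abs W (η.toLp 2 volume)
  have e3 := (L2.integrable_abs_mul_abs V G).const_mul (a * B)
  have e12 : Integrable (fun x ↦ |V x| * |(∂_{m} η).toLp 2 volume x| +
      |W x| * |η.toLp 2 volume x|) := e1.add e2
  calc _ ≤ ∫ x, (|V x| * |(∂_{m} η).toLp 2 volume x| + |W x| * |η.toLp 2 volume x| +
        (a * B) * (|V x| * |G x|)) := by
        refine norm_integral_le_of_norm_le (e12.add e3) ?_
        filter_upwards [Lp.coeFn_sub ((p k).toLp 2 volume) v, Lp.coeFn_sub ((∂_{m} (p k)).toLp 2 volume) G,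
          (p k).coeFn_toLp 2, (∂_{m} (p k)).coeFn_toLp 2, (∂_{m} η).coeFn_toLp 2,
          η.coeFn_toLp 2] with x h1 h2 h3 h4 h5 h6
        rw [hV, hW, h1, h2, Pi.sub_apply, Pi.sub_apply, h3, h4, h5, h6]
        generalize p k x = s, v x = t, G x = g, ∂_{m} (p k) x = q, ∂_{m} η x = d
        have hη := hB x
        generalize η x = e at hη
        have k1 := abs_arctan_mul_div_sub_le ha t s
        have k2 := abs_inv_one_add_sq_sub_le (a * t) (a * s)
        have k3 := abs_inv_one_add_sq_le (a * s)
        rw [← mul_sub, abs_mul, abs_of_pos ha] at k2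
        rw [abs_sub_comm s t, abs_sub_comm q g]
        -- The coefficient difference multiplies the fixed limit `G`. It is controlled by `|v - p
        -- k|`, so boundedness of `η` leaves a product of two L² functions.
        have split : Real.arctan (a * t) / a * d + (1 + (a * t) ^ 2)⁻¹ * g * e -
            (Real.arctan (a * s) / a * d + (1 + (a * s) ^ 2)⁻¹ * q * e) =
            (Real.arctan (a * t) / a - Real.arctan (a * s) / a) * d +
            (1 + (a * s) ^ 2)⁻¹ * ((g - q) * e) +
            ((1 + (a * t) ^ 2)⁻¹ - (1 + (a * s) ^ 2)⁻¹) * e * g := by ring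
        rw [split]
        refine (norm_add₃_le).trans (add_le_add_three ?_ ?_ ?_)
        · rw [norm_mul]
          exact mul_le_mul_of_nonneg_right k1 (abs_nonneg _)
        · rw [norm_mul, norm_mul]
          exact mul_le_of_le_one_left (by positivity) k3
        · rw [norm_mul, norm_mul]
          calc _ ≤ (a * |t - s|) * B * |g| :=
                mul_le_mul_of_nonneg_right (mul_le_mul k2 hη (abs_nonneg _) (by positivity))
                  (abs_nonneg _)
            _ = _ := by ring
    _ ≤ _ := by
        rw [integral_add e12 e3, integral_add e1 e2, integral_const_mul]
        have := L2.integral_abs_mul_abs_le V G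
        gcongr
        · exact L2.integral_abs_mul_abs_le _ _
        · exact L2.integral_abs_mul_abs_le _ _

/-- The weak derivative of a function vanishes almost everywhere on its zero set. -/
theorem ae_eq_zero_of_tendsto_lineDerivOp {p : ℕ → 𝓢(E, ℝ)} {m : E}
    {v G : Lp ℝ 2 (volume : Measure E)}
    (hv : Tendsto (fun k ↦ (p k).toLp 2 volume) atTop (𝓝 v))
    (hG : Tendsto (fun k ↦ (∂_{m} (p k)).toLp 2 volume) atTop (𝓝 G)) :
    ∀ᵐ x, v x = 0 → G x = 0 := by
  have hmeas : MeasurableSet {x | v x = 0} :=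
    (Lp.stronglyMeasurable v).measurable (measurableSet_singleton 0)
  have hloc : LocallyIntegrable ({x | v x = 0}.indicator G) (volume : Measure E) :=
    ((Lp.memLp G).indicator hmeas).locallyIntegrable (by norm_num)
  -- For each test function the integrals with `a = k + 1` have two limits: the integral of `G` over
  -- `{v = 0}` against `g`, by dominated convergence, and zero.
  have key := ae_eq_zero_of_integral_contDiff_smul_eq_zero hloc (fun g hg hgc ↦ ?_)
  · filter_upwards [key] with x hx h0
    rwa [Set.indicator_of_mem (by exact h0)] at hx
  set η : 𝓢(E, ℝ) := hgc.toSchwartzMap hg with hη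
  have hηg : ∀ x, g x = η x := fun x ↦ rfl
  have l1 : Tendsto (fun k : ℕ ↦ ∫ x, (1 + (((k : ℝ) + 1) * v x) ^ 2)⁻¹ * G x * η x) atTop
      (𝓝 (∫ x, g x • {x | v x = 0}.indicator G x)) := by
    refine tendsto_integral_of_dominated_convergence (fun x ↦ ‖G x * η x‖)
      (fun k ↦ ((integral_arctan_comp_mul_lineDerivOp_of_tendsto hv hG η
        (by positivity)).2.1).aestronglyMeasurable)
      ((Lp.memLp G).integrable_mul (η.memLp 2)).norm
      (fun k ↦ ae_of_all _ fun x ↦ ?_) (ae_of_all _ fun x ↦ ?_)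
    · rw [mul_assoc, norm_mul]
      exact mul_le_of_le_one_left (norm_nonneg _) (abs_inv_one_add_sq_le _)
    · by_cases h0 : v x = 0
      · rw [Set.indicator_of_mem (by exact h0)]
        simp [h0, hηg, mul_comm]
      · rw [Set.indicator_of_notMem (by exact h0)]
        have ht : Tendsto (fun k : ℕ ↦ (1 + (((k : ℝ) + 1) * v x) ^ 2)⁻¹) atTop (𝓝 0) := by
          refine tendsto_inv_atTop_zero.comp (tendsto_atTop_add_const_left _ _ ?_)
          have h2 : Tendsto (fun k : ℕ ↦ ((k : ℝ) + 1) ^ 2) atTop atTop :=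
            (tendsto_pow_atTop two_ne_zero).comp
              (tendsto_atTop_add_const_right _ _ tendsto_natCast_atTop_atTop)
          simpa [mul_pow] using h2.atTop_mul_const (by positivity : 0 < v x ^ 2)
        simpa [mul_assoc] using ht.mul_const (G x * η x)
  -- Moving the derivative onto `η` leaves `arctan(a v)/a`, so the integral is `O(1/a)`.
  have l2 : Tendsto (fun k : ℕ ↦ ∫ x, (1 + (((k : ℝ) + 1) * v x) ^ 2)⁻¹ * G x * η x) atTop
      (𝓝 0) := by
    have hc : Tendsto (fun k : ℕ ↦ (Real.pi / 2) * (∫ x, ‖∂_{m} η x‖) * (1 / ((k : ℝ) + 1)))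
        atTop (𝓝 0) := by
      simpa using tendsto_one_div_add_atTop_nhds_zero_nat.const_mul
        ((Real.pi / 2) * (∫ x, ‖∂_{m} η x‖))
    refine squeeze_zero_norm (fun k ↦ ?_) hc
    have hk : (0 : ℝ) < (k : ℝ) + 1 := by positivity
    have h3 := (integral_arctan_comp_mul_lineDerivOp_of_tendsto hv hG η hk).2.2
    rw [← norm_neg, ← h3]
    have e : (Real.pi / 2) * (∫ x, ‖∂_{m} η x‖) * (1 / ((k : ℝ) + 1)) =
        ∫ x, (Real.pi / 2 / ((k : ℝ) + 1)) * ‖∂_{m} η x‖ := by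
      rw [integral_const_mul]
      ring
    rw [e]
    refine norm_integral_le_of_norm_le ((∂_{m} η).integrable.norm.const_mul _)
      (ae_of_all _ fun x ↦ ?_)
    rw [norm_mul, norm_div, Real.norm_of_nonneg hk.le]
    gcongr
    rw [Real.norm_eq_abs, abs_le]
    exact ⟨(Real.neg_pi_div_two_lt_arctan _).le, (Real.arctan_lt_pi_div_two _).le⟩
  exact tendsto_nhds_unique l1 l2

end LevelSets

/-! ### The weak Laplacian on the zero set, in the whole space -/

section Laplacian

open SchwartzMap Laplacian LineDeriv Filter Topology

variable {E : Type*} [NormedAddCommGroup E] [InnerProductSpace ℝ E] [FiniteDimensional ℝ E]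
  [MeasurableSpace E] [BorelSpace E]

theorem coeFn_finset_sum {α ι : Type*} [MeasurableSpace α] {μ : Measure α} (s : Finset ι)
    (f : ι → Lp ℝ 2 μ) : ⇑(∑ i ∈ s, f i) =ᵐ[μ] ∑ i ∈ s, ⇑(f i) := by
  classical
  induction s using Finset.induction_on with
  | empty => simpa using Lp.coeFn_zero ℝ 2 μ
  | insert i s hi ih =>
    rw [Finset.sum_insert hi, Finset.sum_insert hi]
    exact (Lp.coeFn_add _ _).trans (Filter.EventuallyEq.rfl.add ih)

/-- An L²-bounded linear map preserves Cauchy sequences. This yields limits for the resolvent and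
its derivatives. -/
theorem exists_tendsto_of_norm_le {ψ : ℕ → 𝓢(E, ℝ)} {h : Lp ℝ 2 (volume : Measure E)}
    (hψ : Tendsto (fun k ↦ (ψ k).toLp 2 volume) atTop (𝓝 h))
    (T : 𝓢(E, ℝ) →ₗ[ℝ] 𝓢(E, ℝ)) {C : ℝ} (hC : 0 < C)
    (hT : ∀ f, ‖(T f).toLp 2 volume‖ ≤ C * ‖f.toLp 2 volume‖) :
    ∃ g, Tendsto (fun k ↦ (T (ψ k)).toLp 2 volume) atTop (𝓝 g) := by
  refine cauchySeq_tendsto_of_complete ?_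
  have hc := hψ.cauchySeq
  rw [Metric.cauchySeq_iff] at hc ⊢
  intro ε hε
  obtain ⟨N, hN⟩ := hc (ε / C) (by positivity)
  refine ⟨N, fun m hm k hk ↦ ?_⟩
  have h1 := hN m hm k hk
  rw [dist_eq_norm, ← toLpCLM_apply (𝕜 := ℝ), ← toLpCLM_apply (𝕜 := ℝ), ← map_sub] at h1 ⊢
  rw [← map_sub]
  rw [lt_div_iff₀ hC, mul_comm] at h1
  exact (hT _).trans_lt h1

theorem SchwartzMap.inner_toLp (f g : 𝓢(E, ℝ)) :
    ⟪f.toLp 2 volume, g.toLp 2 volume⟫ = ∫ x, f x * g x := by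
  rw [L2.inner_def]
  refine integral_congr_ae ?_
  filter_upwards [f.coeFn_toLp 2, g.coeFn_toLp 2] with x h1 h2
  rw [h1, h2]
  simp [mul_comm]

theorem SchwartzMap.inner_laplacian_right (f g : 𝓢(E, ℝ)) :
    ⟪f.toLp 2 volume, (Δ g).toLp 2 volume⟫ = ⟪(Δ f).toLp 2 volume, g.toLp 2 volume⟫ := by
  rw [inner_toLp, inner_toLp]
  exact integral_mul_laplacian_right_eq_left f g

theorem laplacian_schwartzResolvent_toLp (f : 𝓢(E, ℝ)) :
    (Δ (schwartzResolvent f)).toLp 2 volume =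
      (2 * Real.pi) ^ 2 • ((schwartzResolvent f).toLp 2 volume - f.toLp 2 volume) := by
  rw [laplacian_schwartzResolvent]
  simp only [← toLpCLM_apply (𝕜 := ℝ), map_sub, map_smul]

theorem toLp_eq_sub_laplacian_schwartzResolvent (f : 𝓢(E, ℝ)) :
    f.toLp 2 volume = (schwartzResolvent f).toLp 2 volume -
      ((2 * Real.pi) ^ 2)⁻¹ • (Δ (schwartzResolvent f)).toLp 2 volume := by
  rw [laplacian_schwartzResolvent_toLp, smul_smul, inv_mul_cancel₀ (by positivity), one_smul]
  abel

/-- Symmetry is inherited from the Laplacian: each function is written as `1 - (2π)⁻²Δ` applied to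
its resolvent. -/
theorem inner_schwartzResolvent (f g : 𝓢(E, ℝ)) :
    ⟪(schwartzResolvent f).toLp 2 volume, g.toLp 2 volume⟫ =
      ⟪f.toLp 2 volume, (schwartzResolvent g).toLp 2 volume⟫ := by
  rw [toLp_eq_sub_laplacian_schwartzResolvent f, toLp_eq_sub_laplacian_schwartzResolvent g,
    inner_sub_left, inner_sub_right, inner_smul_left, inner_smul_right, inner_laplacian_right]
  rfl

/-- If `Δ v = F` weakly with `v, F ∈ L²`, then `F = 0` almost everywhere on `{v = 0}`. -/
theorem ae_eq_zero_of_weak_laplacian {v F : Lp ℝ 2 (volume : Measure E)}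
    (h : ∀ φ : 𝓢(E, ℝ), ⟪v, (Δ φ).toLp 2 volume⟫ = ⟪F, φ.toLp 2 volume⟫) :
    ∀ᵐ x, v x = 0 → F x = 0 := by
  have hdense : ∀ y : Lp ℝ 2 (volume : Measure E), ∃ ψ : ℕ → 𝓢(E, ℝ),
      Tendsto (fun k ↦ (ψ k).toLp 2 volume) atTop (𝓝 y) := fun y ↦ by
    obtain ⟨s, hs, hlim⟩ := mem_closure_iff_seq_limit.mp
      (denseRange_toLpCLM (F := ℝ) (μ := (volume : Measure E)) (p := 2) (by norm_num) y)
    choose ψ hψ using hs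
    refine ⟨ψ, ?_⟩
    simpa only [← toLpCLM_apply (𝕜 := ℝ), hψ] using hlim
  have hκ : (2 * Real.pi) ^ 2 ≠ 0 := by positivity
  -- The target is `(1 - (2π)⁻²Δ)v` with `F` in place of `Δv`, so the resolvents of `ψ k` should
  -- approximate `v`.
  obtain ⟨ψ, hψ⟩ := hdense (v - ((2 * Real.pi) ^ 2)⁻¹ • F)
  obtain ⟨v', hv'⟩ := exists_tendsto_of_norm_le hψ schwartzResolvent one_pos
    (fun f ↦ by simpa using norm_schwartzResolvent_le f)
  -- Pairing with Schwartz `φ` and moving the resolvent `R` onto it gives `⟨v', φ⟩ = ⟨v - (2π)⁻²F,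
  -- Rφ⟩`. The weak equation tested with `Rφ` turns this into `⟨v, φ⟩`.
  have hvv : v' = v := by
    rw [← sub_eq_zero, ← inner_self_eq_zero (𝕜 := ℝ)]
    obtain ⟨φ, hφ⟩ := hdense (v' - v)
    refine tendsto_nhds_unique (Tendsto.inner (𝕜 := ℝ) tendsto_const_nhds hφ) ?_
    refine tendsto_const_nhds.congr fun k ↦ ?_
    symm
    rw [inner_sub_left, sub_eq_zero]
    have h1 := hv'.inner (𝕜 := ℝ) (tendsto_const_nhds (x := (φ k).toLp 2 volume))
    refine tendsto_nhds_unique h1 ?_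
    simp only [inner_schwartzResolvent]
    have h2 := hψ.inner (𝕜 := ℝ) (tendsto_const_nhds (x := (schwartzResolvent (φ k)).toLp 2 volume))
    convert h2 using 2
    rw [toLp_eq_sub_laplacian_schwartzResolvent (φ k), inner_sub_right, inner_smul_right, h,
      inner_sub_left, inner_smul_left]
    rfl
  subst hvv
  set b := stdOrthonormalBasis ℝ E with hb
  have hG : ∀ i, ∃ G, Tendsto (fun k ↦ (∂_{b i} (schwartzResolvent (ψ k))).toLp 2 volume)
      atTop (𝓝 G) := fun i ↦
    exists_tendsto_of_norm_le hψ ((lineDerivOpCLM ℝ 𝓢(E, ℝ) (b i)).toLinearMap ∘ₗ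
      schwartzResolvent) (C := 2 * Real.pi * ‖b i‖) (by simp [Real.pi_pos])
      (fun f ↦ norm_lineDerivOp_schwartzResolvent_le f (b i))
  have hH : ∀ i, ∃ H, Tendsto
      (fun k ↦ (∂_{b i} (∂_{b i} (schwartzResolvent (ψ k)))).toLp 2 volume) atTop (𝓝 H) := fun i ↦
    exists_tendsto_of_norm_le hψ ((lineDerivOpCLM ℝ 𝓢(E, ℝ) (b i)).toLinearMap ∘ₗ
      (lineDerivOpCLM ℝ 𝓢(E, ℝ) (b i)).toLinearMap ∘ₗ
      schwartzResolvent) (C := (2 * Real.pi) ^ 2 * ‖b i‖ ^ 2) (by simp [Real.pi_pos])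
      (fun f ↦ norm_lineDerivOp_lineDerivOp_schwartzResolvent_le f (b i))
  choose G hG using hG
  choose H hH using hH
  have hF : F = ∑ i, H i := by
    have h1 := tendsto_finsetSum Finset.univ fun i _ ↦ hH i
    refine tendsto_nhds_unique ?_ h1
    have h2 : ∀ k, ∑ i, (∂_{b i} (∂_{b i} (schwartzResolvent (ψ k)))).toLp 2 volume =
        (2 * Real.pi) ^ 2 • ((schwartzResolvent (ψ k)).toLp 2 volume - (ψ k).toLp 2 volume) := by
      intro k
      rw [← laplacian_schwartzResolvent_toLp, SchwartzMap.laplacian_eq_sum b]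
      simp only [← toLpCLM_apply (𝕜 := ℝ), map_sum]
    simp only [h2]
    convert (hv'.sub hψ).const_smul ((2 * Real.pi) ^ 2) using 2
    rw [sub_sub_cancel, smul_smul, mul_inv_cancel₀ hκ, one_smul]
  -- The level-set lemma is used twice: from `v'` to its first derivative, then from that to the
  -- pure second derivative.
  have hae : ∀ᵐ x, ∀ i, v' x = 0 → H i x = 0 := by
    rw [ae_all_iff]
    intro i
    filter_upwards [ae_eq_zero_of_tendsto_lineDerivOp hv' (hG i),
      ae_eq_zero_of_tendsto_lineDerivOp (hG i) (hH i)] with x h1 h2 h0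
    exact h2 (h1 h0)
  filter_upwards [hae, coeFn_finset_sum Finset.univ H] with x hx hs h0
  rw [hF, hs, Finset.sum_apply]
  exact Finset.sum_eq_zero fun i _ ↦ hx i h0

end Laplacian

/-! ### The space `H¹₀(Ω)`: density, Poincaré inequality and solvability -/

namespace EnergyControl

open Filter Topology

variable {n : ℕ} {Ω : Set (EuclideanSpace ℝ (Fin n))}

theorem IsTestFunction.memLp {φ : EuclideanSpace ℝ (Fin n) → ℝ} (hφ : IsTestFunction Ω φ) :
    MemLp φ 2 (volume.restrict Ω) :=
  hφ.smooth.continuous.memLp_of_hasCompactSupport hφ.compact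

theorem continuous_gradient {φ : EuclideanSpace ℝ (Fin n) → ℝ} (hφ : ContDiff ℝ ∞ φ) :
    Continuous (gradient φ) :=
  (InnerProductSpace.toDual ℝ _).symm.continuous.comp (hφ.continuous_fderiv (by simp))

theorem IsTestFunction.memLp_gradient {φ : EuclideanSpace ℝ (Fin n) → ℝ}
    (hφ : IsTestFunction Ω φ) : MemLp (gradient φ) 2 (volume.restrict Ω) :=
  (continuous_gradient hφ.smooth).memLp_of_hasCompactSupport
    ((hφ.compact.fderiv (𝕜 := ℝ)).comp_left (g := (InnerProductSpace.toDual ℝ _).symm)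
      (map_zero _))

/-- A test function as an element of `H¹₀(Ω)`. -/
noncomputable def IsTestFunction.toH10 {φ : EuclideanSpace ℝ (Fin n) → ℝ} (hφ : IsTestFunction Ω φ) : H10 Ω :=
  ⟨WithLp.toLp 2 (hφ.memLp.toLp φ, hφ.memLp_gradient.toLp (gradient φ)),
    subset_closure ⟨φ, hφ, hφ.memLp.coeFn_toLp, hφ.memLp_gradient.coeFn_toLp⟩⟩

theorem IsTestFunction.toL2_toH10 {φ : EuclideanSpace ℝ (Fin n) → ℝ}
    (hφ : IsTestFunction Ω φ) : toL2 Ω hφ.toH10 = hφ.memLp.toLp φ := rfl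

theorem IsTestFunction.grad_toH10 {φ : EuclideanSpace ℝ (Fin n) → ℝ}
    (hφ : IsTestFunction Ω φ) : grad Ω hφ.toH10 = hφ.memLp_gradient.toLp (gradient φ) := rfl

theorem H10.induction {P : H10 Ω → Prop} (hP : IsClosed {v | P v})
    (h : ∀ (φ : EuclideanSpace ℝ (Fin n) → ℝ) (hφ : IsTestFunction Ω φ), P hφ.toH10)
    (v : H10 Ω) : P v := by
  obtain ⟨s, hs, hlim⟩ := mem_closure_iff_seq_limit.mp v.2
  have hP' : ∀ k, ∃ t : H10 Ω, (t : WithLp 2 (L2 Ω × L2Vec Ω)) = s k ∧ P t := fun k ↦ by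
    obtain ⟨φ, hφ, h1, h2⟩ := hs k
    refine ⟨hφ.toH10, ?_, h φ hφ⟩
    refine (WithLp.ofLp_injective 2) (Prod.ext ?_ ?_)
    · exact Lp.ext (hφ.memLp.coeFn_toLp.trans h1.symm)
    · exact Lp.ext (hφ.memLp_gradient.coeFn_toLp.trans h2.symm)
  choose t ht htP using hP'
  refine hP.mem_of_tendsto (f := t) (b := atTop) ?_ (Eventually.of_forall htP)
  rw [tendsto_subtype_rng]
  simpa only [ht] using hlim

/-- The weak derivative `H¹₀(Ω) → L²(Ω)` in the direction `m`. -/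
noncomputable def partialL2 (Ω : Set (EuclideanSpace ℝ (Fin n))) (m : EuclideanSpace ℝ (Fin n)) :
    H10 Ω →L[ℝ] L2 Ω :=
  ((innerSL ℝ m).compLpL 2 (volume.restrict Ω)).comp (grad Ω)

theorem coeFn_partialL2 (m : EuclideanSpace ℝ (Fin n)) (v : H10 Ω) :
    partialL2 Ω m v =ᵐ[volume.restrict Ω] fun x ↦ ⟪m, grad Ω v x⟫ :=
  (innerSL ℝ m).coeFn_compLp (grad Ω v)

theorem norm_partialL2_le (m : EuclideanSpace ℝ (Fin n)) (v : H10 Ω) :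
    ‖partialL2 Ω m v‖ ≤ ‖m‖ * ‖grad Ω v‖ := by
  have h := (innerSL ℝ m).norm_compLp_le (grad Ω v)
  rwa [innerSL_apply_norm] at h

theorem IsTestFunction.coeFn_partialL2_toH10 {φ : EuclideanSpace ℝ (Fin n) → ℝ}
    (hφ : IsTestFunction Ω φ) (m : EuclideanSpace ℝ (Fin n)) :
    partialL2 Ω m hφ.toH10 =ᵐ[volume.restrict Ω] fun x ↦ fderiv ℝ φ x m := by
  filter_upwards [coeFn_partialL2 m hφ.toH10, hφ.memLp_gradient.coeFn_toLp] with x h1 h2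
  rw [h1, hφ.grad_toH10, h2, real_inner_comm, inner_gradient_left]

theorem contDiff_fderiv_apply {η : EuclideanSpace ℝ (Fin n) → ℝ} (hη : ContDiff ℝ ∞ η)
    (m : EuclideanSpace ℝ (Fin n)) : ContDiff ℝ ∞ fun x ↦ fderiv ℝ η x m :=
  (hη.fderiv_right (by simp)).clm_apply contDiff_const

theorem inner_toLp_right {μ : Measure (EuclideanSpace ℝ (Fin n))} (f : Lp ℝ 2 μ)
    {g : EuclideanSpace ℝ (Fin n) → ℝ} (hg : MemLp g 2 μ) :
    ⟪f, hg.toLp g⟫ = ∫ x, f x * g x ∂μ := by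
  rw [L2.inner_def]
  refine integral_congr_ae ?_
  filter_upwards [hg.coeFn_toLp] with x h
  rw [h]
  simp [mul_comm]

theorem IsTestFunction.eq_zero_of_notMem {φ : EuclideanSpace ℝ (Fin n) → ℝ}
    (hφ : IsTestFunction Ω φ) {x : EuclideanSpace ℝ (Fin n)} (hx : x ∉ Ω) : φ x = 0 :=
  image_eq_zero_of_notMem_tsupport fun h ↦ hx (hφ.subset h)

theorem IsTestFunction.fderiv_eq_zero_of_notMem {φ : EuclideanSpace ℝ (Fin n) → ℝ}
    (hφ : IsTestFunction Ω φ) {x : EuclideanSpace ℝ (Fin n)} (hx : x ∉ Ω) : fderiv ℝ φ x = 0 :=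
  image_eq_zero_of_notMem_tsupport fun h ↦ hx (hφ.subset (tsupport_fderiv_subset ℝ h))

/-- The support of `η` may leave `Ω`: the approximants of `w` are supported inside `Ω`, so there is
no boundary term. -/
theorem integral_toL2_mul_fderiv (w : H10 Ω) {η : EuclideanSpace ℝ (Fin n) → ℝ}
    (hη : ContDiff ℝ ∞ η) (hc : HasCompactSupport η) (m : EuclideanSpace ℝ (Fin n)) :
    ∫ x in Ω, toL2 Ω w x * fderiv ℝ η x m = -∫ x in Ω, partialL2 Ω m w x * η x := by
  have hm := (hη.continuous.memLp_of_hasCompactSupport hc :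
    MemLp η 2 (volume.restrict Ω))
  have hcont := (contDiff_fderiv_apply hη m).continuous
  have hsupp : HasCompactSupport fun x ↦ fderiv ℝ η x m :=
    (hc.fderiv (𝕜 := ℝ)).comp_left (g := fun T : EuclideanSpace ℝ (Fin n) →L[ℝ] ℝ ↦ T m) rfl
  have hm' : MemLp (fun x ↦ fderiv ℝ η x m) 2 (volume.restrict Ω) :=
    hcont.memLp_of_hasCompactSupport hsupp
  rw [← inner_toLp_right _ hm, ← inner_toLp_right _ hm']
  refine H10.induction (P := fun w ↦ ⟪toL2 Ω w, hm'.toLp _⟫ = -⟪partialL2 Ω m w, hm.toLp η⟫)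
    (isClosed_eq (by fun_prop) (by fun_prop)) (fun φ hφ ↦ ?_) w
  rw [inner_toLp_right, inner_toLp_right]
  have e1 : ∫ x in Ω, toL2 Ω hφ.toH10 x * fderiv ℝ η x m = ∫ x, φ x * fderiv ℝ η x m := by
    refine Eq.trans ?_ (setIntegral_eq_integral_of_forall_compl_eq_zero (s := Ω)
      (fun x hx ↦ by rw [hφ.eq_zero_of_notMem hx, zero_mul]))
    refine integral_congr_ae ?_
    filter_upwards [hφ.memLp.coeFn_toLp] with x h
    rw [hφ.toL2_toH10, h]
  have e2 : ∫ x in Ω, partialL2 Ω m hφ.toH10 x * η x = ∫ x, fderiv ℝ φ x m * η x := by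
    refine Eq.trans ?_ (setIntegral_eq_integral_of_forall_compl_eq_zero (s := Ω)
      (fun x hx ↦ by rw [hφ.fderiv_eq_zero_of_notMem hx]; simp))
    refine integral_congr_ae ?_
    filter_upwards [hφ.coeFn_partialL2_toH10 m] with x h
    rw [h]
  rw [e1, e2]
  have hφc := hφ.smooth.continuous
  have hφc' := (contDiff_fderiv_apply hφ.smooth m).continuous
  have hηc := hη.continuous
  refine integral_mul_fderiv_eq_neg_fderiv_mul_of_integrable ?_ ?_ ?_
    (fun x _ ↦ (hφ.smooth.differentiable (by simp)) x)
    (fun x _ ↦ (hη.differentiable (by simp)) x)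
  · exact (hφc'.mul hηc).integrable_of_hasCompactSupport hc.mul_left
  · exact (hφc.mul hcont).integrable_of_hasCompactSupport hφ.compact.mul_right
  · exact (hφc.mul hηc).integrable_of_hasCompactSupport hc.mul_left

/-- The Poincaré inequality on a bounded set. -/
theorem exists_norm_toL2_le (hn : 1 ≤ n) (hΩb : Bornology.IsBounded Ω) :
    ∃ C : ℝ, 0 ≤ C ∧ ∀ v : H10 Ω, ‖toL2 Ω v‖ ≤ C * ‖grad Ω v‖ := by
  obtain ⟨R, hR0, hR⟩ := hΩb.exists_pos_norm_le
  set m : EuclideanSpace ℝ (Fin n) := EuclideanSpace.single ⟨0, hn⟩ 1 with hm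
  have hm1 : ‖m‖ = 1 := by simp [hm]
  refine ⟨2 * R, by positivity, H10.induction (isClosed_le (by fun_prop) (by fun_prop)) ?_⟩
  intro φ hφ
  have hφc := hφ.smooth.continuous
  have hφc' := (contDiff_fderiv_apply hφ.smooth m).continuous
  have hsq : ∀ x, fderiv ℝ (fun x ↦ φ x * φ x) x m = 2 * (φ x * fderiv ℝ φ x m) := fun x ↦ by
    have hd := (hφ.smooth.differentiable (by simp)) x
    rw [fderiv_fun_mul hd hd]
    simp only [_root_.add_apply, _root_.smul_apply, smul_eq_mul]
    ring
  have hlin : ∀ x, fderiv ℝ (fun x : EuclideanSpace ℝ (Fin n) ↦ ⟪m, x⟫) x m = 1 := fun x ↦ by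
    have : fderiv ℝ (innerSL ℝ m) x = innerSL ℝ m := (innerSL ℝ m).fderiv
    change fderiv ℝ (innerSL ℝ m) x m = 1
    rw [this, innerSL_apply_apply, real_inner_self_eq_norm_sq, hm1, one_pow]
  -- Since `∂_m⟨m, x⟩ = 1`, integration by parts gives `‖φ‖² = -∫ ⟨m, x⟩ 2φ ∂_mφ`. The bound `|⟨m,
  -- x⟩| ≤ R` on `Ω` then yields the constant `2R`.
  have hparts := integral_mul_fderiv_eq_neg_fderiv_mul_of_integrable (μ := volume) (v := m)
    (f := fun x : EuclideanSpace ℝ (Fin n) ↦ ⟪m, x⟫) (g := fun x ↦ φ x * φ x)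
    (by
      simp only [hlin, one_mul]
      exact (hφc.mul hφc).integrable_of_hasCompactSupport hφ.compact.mul_right)
    (by
      simp only [hsq]
      exact Continuous.integrable_of_hasCompactSupport (by fun_prop)
        ((hφ.compact.mul_right (f' := fun x ↦ fderiv ℝ φ x m)).comp_left
          (g := fun t : ℝ ↦ 2 * t) (by simp)).mul_left)
    (Continuous.integrable_of_hasCompactSupport (by fun_prop)
      (hφ.compact.mul_right (f' := φ)).mul_left)
    (fun x _ ↦ (innerSL ℝ m).differentiableAt)
    (fun x _ ↦ ((hφ.smooth.differentiable (by simp)) x).mul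
      ((hφ.smooth.differentiable (by simp)) x))
  simp only [hsq, hlin, one_mul] at hparts
  have h1 : ‖toL2 Ω hφ.toH10‖ ^ 2 = ∫ x, φ x * φ x := by
    rw [← real_inner_self_eq_norm_sq]
    nth_rewrite 2 [hφ.toL2_toH10]
    rw [inner_toLp_right]
    refine Eq.trans ?_ (setIntegral_eq_integral_of_forall_compl_eq_zero (s := Ω)
      (fun x hx ↦ by rw [hφ.eq_zero_of_notMem hx, zero_mul]))
    refine integral_congr_ae ?_
    filter_upwards [hφ.memLp.coeFn_toLp] with x h
    rw [hφ.toL2_toH10, h]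
  have h2 : ‖toL2 Ω hφ.toH10‖ ^ 2 ≤
      2 * R * (‖toL2 Ω hφ.toH10‖ * ‖partialL2 Ω m hφ.toH10‖) := by
    have hab := L2.integrable_abs_mul_abs (toL2 Ω hφ.toH10) (partialL2 Ω m hφ.toH10)
    calc ‖toL2 Ω hφ.toH10‖ ^ 2 = -∫ x, ⟪m, x⟫ * (2 * (φ x * fderiv ℝ φ x m)) := by
          rw [h1, hparts, neg_neg]
      _ ≤ ‖∫ x, ⟪m, x⟫ * (2 * (φ x * fderiv ℝ φ x m))‖ := neg_le_abs _
      _ = ‖∫ x in Ω, ⟪m, x⟫ * (2 * (φ x * fderiv ℝ φ x m))‖ := by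
          rw [← setIntegral_eq_integral_of_forall_compl_eq_zero (s := Ω)
            (fun x hx ↦ by rw [hφ.eq_zero_of_notMem hx]; simp)]
      _ ≤ ∫ x in Ω, 2 * R * (|toL2 Ω hφ.toH10 x| * |partialL2 Ω m hφ.toH10 x|) := by
          refine norm_integral_le_of_norm_le (hab.const_mul _) ?_
          have hΩ' : ∀ᵐ x ∂(volume.restrict Ω), ‖x‖ ≤ R := by
            refine (ae_restrict_iff (measurableSet_le (by fun_prop) (by fun_prop))).mpr ?_
            exact ae_of_all _ fun x hx ↦ hR x hx
          filter_upwards [hΩ', hφ.memLp.coeFn_toLp, hφ.coeFn_partialL2_toH10 m] with x hx h3 h4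
          rw [h4, hφ.toL2_toH10, h3, norm_mul, norm_mul, norm_mul]
          have h5 : ‖⟪m, x⟫‖ ≤ R := (norm_inner_le_norm m x).trans (by rw [hm1, one_mul]; exact hx)
          calc _ ≤ R * (‖(2 : ℝ)‖ * (‖φ x‖ * ‖fderiv ℝ φ x m‖)) :=
                mul_le_mul_of_nonneg_right h5 (by positivity)
            _ = _ := by
                rw [Real.norm_ofNat, Real.norm_eq_abs, Real.norm_eq_abs]
                ring
      _ ≤ _ := by
          rw [integral_const_mul]
          exact mul_le_mul_of_nonneg_left (L2.integral_abs_mul_abs_le _ _) (by positivity)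
  have h3 := norm_partialL2_le m hφ.toH10
  rw [hm1, one_mul] at h3
  rcases (norm_nonneg (toL2 Ω hφ.toH10)).eq_or_lt with h0 | h0
  · rw [← h0]
    positivity
  · have h4 : ‖toL2 Ω hφ.toH10‖ * ‖toL2 Ω hφ.toH10‖ ≤
        ‖toL2 Ω hφ.toH10‖ * (2 * R * ‖partialL2 Ω m hφ.toH10‖) := by
      nlinarith [h2]
    exact (le_of_mul_le_mul_left h4 h0).trans (mul_le_mul_of_nonneg_left h3 (by positivity))

/-- Every `y ∈ L²(Ω)` equals `-Δ v` for some `v ∈ H¹₀(Ω)`. -/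
theorem exists_neg_laplacian_eq (hn : 1 ≤ n) (hΩb : Bornology.IsBounded Ω) (y : L2 Ω) :
    ∃ v : H10 Ω, ∀ s : H10 Ω, ⟪grad Ω v, grad Ω s⟫ = ⟪y, toL2 Ω s⟫ := by
  obtain ⟨C, hC0, hC⟩ := exists_norm_toL2_le hn hΩb
  have hcs : CompleteSpace (H10 Ω) := (testPairs Ω).isClosed_topologicalClosure.completeSpace_coe
  set B : H10 Ω →L[ℝ] H10 Ω →L[ℝ] ℝ := (innerSL ℝ).bilinearComp (grad Ω) (grad Ω) with hB
  have hco : IsCoercive B := by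
    -- By Poincaré, `‖v‖² = ‖v‖²_{L²} + ‖∇v‖² ≤ (C² + 1)‖∇v‖²`, which is Lax–Milgram coercivity.
    refine ⟨(C ^ 2 + 1)⁻¹, by positivity, fun v ↦ ?_⟩
    have h1 : ‖v‖ ^ 2 = ‖toL2 Ω v‖ ^ 2 + ‖grad Ω v‖ ^ 2 :=
      WithLp.prod_norm_sq_eq_of_L2 (v : WithLp 2 (L2 Ω × L2Vec Ω))
    have h2 : B v v = ‖grad Ω v‖ ^ 2 := real_inner_self_eq_norm_sq (grad Ω v)
    rw [h2, mul_assoc, ← sq, inv_mul_le_iff₀ (by positivity), h1]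
    have h3 := pow_le_pow_left₀ (norm_nonneg _) (hC v) 2
    rw [mul_pow] at h3
    linarith
  set f : H10 Ω := (InnerProductSpace.toDual ℝ (H10 Ω)).symm (ofL2 Ω y) with hf
  refine ⟨hco.continuousLinearEquivOfBilin.symm
    ((InnerProductSpace.toDual ℝ (H10 Ω)).symm (ofL2 Ω y)), fun s ↦ ?_⟩
  have h := hco.continuousLinearEquivOfBilin_apply (hco.continuousLinearEquivOfBilin.symm f) s
  rw [ContinuousLinearEquiv.apply_symm_apply, hf,
    InnerProductSpace.toDual_symm_apply] at h
  exact h.symm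

/-! ### Localization by cutoffs: `Δw = 0` a.e. on `{w = 0}` -/

theorem IsTestFunction.fderiv_apply {χ : EuclideanSpace ℝ (Fin n) → ℝ}
    (hχ : IsTestFunction Ω χ) (m : EuclideanSpace ℝ (Fin n)) :
    IsTestFunction Ω fun x ↦ fderiv ℝ χ x m :=
  ⟨contDiff_fderiv_apply hχ.smooth m, hχ.compact.fderiv_apply ℝ m,
    (tsupport_fderiv_apply_subset ℝ m).trans hχ.subset⟩

theorem IsTestFunction.mul {χ φ : EuclideanSpace ℝ (Fin n) → ℝ}
    (hχ : IsTestFunction Ω χ) (hφ : ContDiff ℝ ∞ φ) : IsTestFunction Ω fun x ↦ χ x * φ x :=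
  ⟨hχ.smooth.mul hφ, hχ.compact.mul_right,
    (tsupport_mul_subset_left).trans hχ.subset⟩

theorem IsTestFunction.memLp_mul {χ : EuclideanSpace ℝ (Fin n) → ℝ}
    (hχ : IsTestFunction Ω χ) (f : L2 Ω) :
    MemLp (fun x ↦ f x * χ x) 2 (volume.restrict Ω) := by
  have h : MemLp χ ⊤ (volume.restrict Ω) :=
    hχ.smooth.continuous.memLp_of_hasCompactSupport hχ.compact
  exact h.mul' (Lp.memLp f)

theorem IsTestFunction.integrable_mul {χ : EuclideanSpace ℝ (Fin n) → ℝ}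
    (hχ : IsTestFunction Ω χ) (f : L2 Ω) :
    Integrable (fun x ↦ f x * χ x) (volume.restrict Ω) :=
  (Lp.memLp f).integrable_mul hχ.memLp

theorem inner_grad_eq_sum (w : H10 Ω) {ψ : EuclideanSpace ℝ (Fin n) → ℝ}
    (hψ : IsTestFunction Ω ψ) :
    ⟪grad Ω w, grad Ω hψ.toH10⟫ = ∑ i, ∫ x in Ω,
      partialL2 Ω (EuclideanSpace.basisFun (Fin n) ℝ i) w x *
        fderiv ℝ ψ x (EuclideanSpace.basisFun (Fin n) ℝ i) := by
  set b := EuclideanSpace.basisFun (Fin n) ℝ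
  rw [L2.inner_def, ← integral_finsetSum _ fun i _ ↦ (hψ.fderiv_apply (b i)).integrable_mul _]
  refine integral_congr_ae ?_
  have h1 : ∀ᵐ x ∂(volume.restrict Ω), ∀ i, partialL2 Ω (b i) w x = ⟪b i, grad Ω w x⟫ :=
    ae_all_iff.mpr fun i ↦ coeFn_partialL2 (b i) w
  filter_upwards [h1, hψ.memLp_gradient.coeFn_toLp] with x h2 h3
  rw [hψ.grad_toH10, h3, ← b.sum_inner_mul_inner]
  refine Finset.sum_congr rfl fun i _ ↦ ?_
  rw [h2 i, real_inner_comm, ← inner_gradient_left]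
  rw [real_inner_comm (gradient ψ x)]

theorem sum_integral_mul_fderiv_fderiv {w : H10 Ω} {q : L2 Ω}
    (hq : laplacian Ω w = ofL2 Ω q) {ψ : EuclideanSpace ℝ (Fin n) → ℝ}
    (hψ : IsTestFunction Ω ψ) :
    ∑ i, ∫ x in Ω, toL2 Ω w x * fderiv ℝ
      (fun y ↦ fderiv ℝ ψ y (EuclideanSpace.basisFun (Fin n) ℝ i)) x
        (EuclideanSpace.basisFun (Fin n) ℝ i) = ∫ x in Ω, q x * ψ x := by
  have h := DFunLike.congr_fun hq hψ.toH10
  change -⟪grad Ω w, grad Ω hψ.toH10⟫ = ⟪q, toL2 Ω hψ.toH10⟫ at h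
  rw [hψ.toL2_toH10, inner_toLp_right, inner_grad_eq_sum, ← Finset.sum_neg_distrib] at h
  rw [← h]
  refine Finset.sum_congr rfl fun i _ ↦ ?_
  have := hψ.fderiv_apply (EuclideanSpace.basisFun (Fin n) ℝ i)
  exact integral_toL2_mul_fderiv w this.smooth this.compact _

/-- This form puts every derivative of `φ` on a product with `χ` or `∂χ`. When `χ` is a test
function, so are these products, even if `φ` is only smooth. -/
theorem mul_fderiv_fderiv_eq {χ φ : EuclideanSpace ℝ (Fin n) → ℝ} (hχ : ContDiff ℝ ∞ χ)
    (hφ : ContDiff ℝ ∞ φ) (m x : EuclideanSpace ℝ (Fin n)) :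
    χ x * fderiv ℝ (fun y ↦ fderiv ℝ φ y m) x m =
      fderiv ℝ (fun y ↦ fderiv ℝ (fun z ↦ χ z * φ z) y m) x m -
      2 * fderiv ℝ (fun y ↦ fderiv ℝ χ y m * φ y) x m +
      fderiv ℝ (fun y ↦ fderiv ℝ χ y m) x m * φ x := by
  have d : ∀ {f : EuclideanSpace ℝ (Fin n) → ℝ}, ContDiff ℝ ∞ f → ∀ x, DifferentiableAt ℝ f x :=
    fun hf x ↦ hf.differentiable (by simp) x
  have hχ' := contDiff_fderiv_apply hχ m
  have hφ' := contDiff_fderiv_apply hφ m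
  have e : (fun y ↦ fderiv ℝ (fun z ↦ χ z * φ z) y m) =
      fun y ↦ χ y * fderiv ℝ φ y m + φ y * fderiv ℝ χ y m := by
    ext y
    rw [fderiv_fun_mul (d hχ y) (d hφ y)]
    simp
  rw [e, fderiv_fun_add ((d hχ x).fun_mul (d hφ' x)) ((d hφ x).fun_mul (d hχ' x)),
    fderiv_fun_mul (d hχ x) (d hφ' x), fderiv_fun_mul (d hφ x) (d hχ' x),
    fderiv_fun_mul (d hχ' x) (d hφ x)]
  simp only [_root_.add_apply, _root_.smul_apply, smul_eq_mul]
  ring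

/-- The weak Laplacian of `χ w`, where `q` is the weak Laplacian of `w`. -/
noncomputable def cutoffLaplacian (χ : EuclideanSpace ℝ (Fin n) → ℝ) (w : H10 Ω) (q : L2 Ω) :
    EuclideanSpace ℝ (Fin n) → ℝ :=
  fun x ↦ q x * χ x + ∑ i, (2 * (partialL2 Ω (EuclideanSpace.basisFun (Fin n) ℝ i) w x *
      fderiv ℝ χ x (EuclideanSpace.basisFun (Fin n) ℝ i)) +
    toL2 Ω w x * fderiv ℝ (fun y ↦ fderiv ℝ χ y (EuclideanSpace.basisFun (Fin n) ℝ i)) x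
      (EuclideanSpace.basisFun (Fin n) ℝ i))

theorem memLp_cutoffLaplacian {χ : EuclideanSpace ℝ (Fin n) → ℝ} (hχ : IsTestFunction Ω χ)
    (w : H10 Ω) (q : L2 Ω) : MemLp (cutoffLaplacian χ w q) 2 (volume.restrict Ω) := by
  refine (hχ.memLp_mul q).add (memLp_finsetSum _ fun i _ ↦ ?_)
  exact (((hχ.fderiv_apply _).memLp_mul _).const_mul 2).add
    (((hχ.fderiv_apply _).fderiv_apply _).memLp_mul _)

/-- In the product identity the first term is the equation for `w` tested with `χφ`, the middle one
is integrated by parts once onto `w`, and the last is left alone. -/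
theorem integral_mul_laplacian_eq {w : H10 Ω} {q : L2 Ω} (hq : laplacian Ω w = ofL2 Ω q)
    {χ φ : EuclideanSpace ℝ (Fin n) → ℝ} (hχ : IsTestFunction Ω χ) (hφ : ContDiff ℝ ∞ φ) :
    ∫ x in Ω, toL2 Ω w x * χ x * ∑ i, fderiv ℝ
      (fun y ↦ fderiv ℝ φ y (EuclideanSpace.basisFun (Fin n) ℝ i)) x
        (EuclideanSpace.basisFun (Fin n) ℝ i) = ∫ x in Ω, cutoffLaplacian χ w q x * φ x := by
  set b := EuclideanSpace.basisFun (Fin n) ℝ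
  have i1 : ∀ i, Integrable (fun x ↦ toL2 Ω w x * fderiv ℝ
      (fun y ↦ fderiv ℝ (fun z ↦ χ z * φ z) y (b i)) x (b i)) (volume.restrict Ω) := fun i ↦
    (((hχ.mul hφ).fderiv_apply (b i)).fderiv_apply (b i)).integrable_mul _
  have i2 : ∀ i, Integrable (fun x ↦ toL2 Ω w x * fderiv ℝ
      (fun y ↦ fderiv ℝ χ y (b i) * φ y) x (b i)) (volume.restrict Ω) := fun i ↦
    (((hχ.fderiv_apply (b i)).mul hφ).fderiv_apply (b i)).integrable_mul _
  have i2' : ∀ i, Integrable (fun x ↦ partialL2 Ω (b i) w x *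
      (fderiv ℝ χ x (b i) * φ x)) (volume.restrict Ω) := fun i ↦
    ((hχ.fderiv_apply (b i)).mul hφ).integrable_mul _
  have i3 : ∀ i, Integrable (fun x ↦ toL2 Ω w x * (fderiv ℝ
      (fun y ↦ fderiv ℝ χ y (b i)) x (b i) * φ x)) (volume.restrict Ω) := fun i ↦
    (((hχ.fderiv_apply (b i)).fderiv_apply (b i)).mul hφ).integrable_mul _
  have i4 : Integrable (fun x ↦ q x * (χ x * φ x)) (volume.restrict Ω) :=
    (hχ.mul hφ).integrable_mul _
  have i5 : ∀ i, Integrable (fun x ↦ toL2 Ω w x * fderiv ℝ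
      (fun y ↦ fderiv ℝ (fun z ↦ χ z * φ z) y (b i)) x (b i) -
      2 * (toL2 Ω w x * fderiv ℝ (fun y ↦ fderiv ℝ χ y (b i) * φ y) x (b i)))
      (volume.restrict Ω) := fun i ↦ (i1 i).sub ((i2 i).const_mul 2)
  have i6 : ∀ i, Integrable (fun x ↦ toL2 Ω w x * fderiv ℝ
      (fun y ↦ fderiv ℝ (fun z ↦ χ z * φ z) y (b i)) x (b i) -
      2 * (toL2 Ω w x * fderiv ℝ (fun y ↦ fderiv ℝ χ y (b i) * φ y) x (b i)) +
      toL2 Ω w x * (fderiv ℝ (fun y ↦ fderiv ℝ χ y (b i)) x (b i) * φ x))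
      (volume.restrict Ω) := fun i ↦ (i5 i).add (i3 i)
  have i7 : ∀ i, Integrable (fun x ↦ 2 * (partialL2 Ω (b i) w x *
      (fderiv ℝ χ x (b i) * φ x)) +
      toL2 Ω w x * (fderiv ℝ (fun y ↦ fderiv ℝ χ y (b i)) x (b i) * φ x))
      (volume.restrict Ω) := fun i ↦ ((i2' i).const_mul 2).add (i3 i)
  have hp : ∀ i, ∫ x in Ω, toL2 Ω w x * fderiv ℝ
      (fun y ↦ fderiv ℝ χ y (b i) * φ y) x (b i) =
      -∫ x in Ω, partialL2 Ω (b i) w x * (fderiv ℝ χ x (b i) * φ x) := fun i ↦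
    integral_toL2_mul_fderiv w ((hχ.fderiv_apply (b i)).mul hφ).smooth
      ((hχ.fderiv_apply (b i)).mul hφ).compact _
  calc _ = ∫ x in Ω, ∑ i, (toL2 Ω w x * fderiv ℝ
          (fun y ↦ fderiv ℝ (fun z ↦ χ z * φ z) y (b i)) x (b i) -
        2 * (toL2 Ω w x * fderiv ℝ (fun y ↦ fderiv ℝ χ y (b i) * φ y) x (b i)) +
        toL2 Ω w x * (fderiv ℝ (fun y ↦ fderiv ℝ χ y (b i)) x (b i) * φ x)) := by
        refine integral_congr_ae (ae_of_all _ fun x ↦ ?_)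
        simp only [Finset.mul_sum]
        refine Finset.sum_congr rfl fun i _ ↦ ?_
        rw [mul_assoc, mul_fderiv_fderiv_eq hχ.smooth hφ]
        ring
    _ = ∑ i, ((∫ x in Ω, toL2 Ω w x * fderiv ℝ
          (fun y ↦ fderiv ℝ (fun z ↦ χ z * φ z) y (b i)) x (b i)) +
        (2 * (∫ x in Ω, partialL2 Ω (b i) w x * (fderiv ℝ χ x (b i) * φ x)) +
        ∫ x in Ω, toL2 Ω w x * (fderiv ℝ (fun y ↦ fderiv ℝ χ y (b i)) x (b i) * φ x))) := by
        rw [integral_finsetSum _ fun i _ ↦ i6 i]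
        refine Finset.sum_congr rfl fun i _ ↦ ?_
        rw [integral_add (i5 i) (i3 i),
          integral_sub (i1 i) ((i2 i).const_mul 2), integral_const_mul, hp]
        ring
    _ = (∫ x in Ω, q x * (χ x * φ x)) +
        ∫ x in Ω, ∑ i, (2 * (partialL2 Ω (b i) w x * (fderiv ℝ χ x (b i) * φ x)) +
          toL2 Ω w x * (fderiv ℝ (fun y ↦ fderiv ℝ χ y (b i)) x (b i) * φ x)) := by
        rw [Finset.sum_add_distrib, sum_integral_mul_fderiv_fderiv hq (hχ.mul hφ),
          integral_finsetSum _ fun i _ ↦ i7 i]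
        congr 1
        refine Finset.sum_congr rfl fun i _ ↦ ?_
        rw [integral_add ((i2' i).const_mul 2) (i3 i), integral_const_mul]
    _ = _ := by
        rw [← integral_add i4 (integrable_finsetSum _ fun i _ ↦ i7 i)]
        refine integral_congr_ae (ae_of_all _ fun x ↦ ?_)
        simp only [cutoffLaplacian, add_mul, Finset.sum_mul]
        congr 1
        · ring
        · refine Finset.sum_congr rfl fun i _ ↦ ?_
          ring

/-- Extended by zero, `χw` and its weak Laplacian satisfy the equation against every Schwartz
function, so the whole-space result applies. -/
theorem ae_cutoffLaplacian_eq_zero (hΩ : IsOpen Ω) {w : H10 Ω} {q : L2 Ω}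
    (hq : laplacian Ω w = ofL2 Ω q) {χ : EuclideanSpace ℝ (Fin n) → ℝ}
    (hχ : IsTestFunction Ω χ) :
    ∀ᵐ x ∂(volume.restrict Ω), toL2 Ω w x = 0 → cutoffLaplacian χ w q x = 0 := by
  have hΩm := hΩ.measurableSet
  have hv := (memLp_indicator_iff_restrict hΩm).mpr (hχ.memLp_mul (toL2 Ω w))
  have hF := (memLp_indicator_iff_restrict hΩm).mpr (memLp_cutoffLaplacian hχ w q)
  have hint : ∀ (f φ : EuclideanSpace ℝ (Fin n) → ℝ),
      ∫ x, Ω.indicator f x * φ x = ∫ x in Ω, f x * φ x := fun f φ ↦ by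
    rw [← integral_indicator hΩm]
    simp only [Set.indicator_mul_left]
  have key := ae_eq_zero_of_weak_laplacian (v := hv.toLp _) (F := hF.toLp _) fun φ ↦ by
    rw [SchwartzMap.toLp, SchwartzMap.toLp, inner_toLp_right, inner_toLp_right]
    have e : ∀ {f : EuclideanSpace ℝ (Fin n) → ℝ}
        (hf : MemLp (Ω.indicator f) 2 volume) (ψ : EuclideanSpace ℝ (Fin n) → ℝ),
        ∫ x, hf.toLp _ x * ψ x = ∫ x in Ω, f x * ψ x := fun hf ψ ↦ by
      rw [← hint]
      refine integral_congr_ae ?_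
      filter_upwards [hf.coeFn_toLp] with x h
      rw [h]
    rw [e, e, ← integral_mul_laplacian_eq hq hχ (φ.smooth ⊤)]
    refine integral_congr_ae (ae_of_all _ fun x ↦ ?_)
    simp only [SchwartzMap.laplacian_eq_sum (EuclideanSpace.basisFun (Fin n) ℝ)]
    rw [sum_apply]
    rfl
  rw [ae_restrict_iff' hΩm]
  filter_upwards [key, hv.coeFn_toLp, hF.coeFn_toLp] with x h1 h2 h3 hx h0
  rw [h2, h3, Set.indicator_of_mem hx, Set.indicator_of_mem hx, h0, zero_mul] at h1
  exact h1 rfl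

/-- If `w ∈ H¹₀(Ω)` and `Δ w ∈ L²(Ω)`, then `Δ w = 0` almost everywhere on `{w = 0}`. -/
theorem ae_laplacian_eq_zero (hΩ : IsOpen Ω) {w : H10 Ω} {q : L2 Ω}
    (hq : laplacian Ω w = ofL2 Ω q) :
    ∀ᵐ x ∂(volume.restrict Ω), toL2 Ω w x = 0 → q x = 0 := by
  rw [ae_restrict_iff' hΩ.measurableSet, ae_iff]
  refine measure_null_of_locally_null _ fun x hx ↦ ?_
  have hxΩ : x ∈ Ω := by
    by_contra h
    exact hx fun h' ↦ (h h').elim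
  obtain ⟨r, hr0, hr⟩ := Metric.isOpen_iff.mp hΩ x hxΩ
  -- Equal to 1 near each point of the `r/4` ball, where all correction terms vanish and the cutoff
  -- Laplacian is `q`. The support radius `r/2` keeps it inside `Ω`.
  let f : ContDiffBump x := ⟨r / 4, r / 2, by positivity, by linarith⟩
  have hf : IsTestFunction Ω f := by
    refine ⟨f.contDiff, f.hasCompactSupport, ?_⟩
    rw [f.tsupport_eq]
    exact (Metric.closedBall_subset_ball (by change r / 2 < r; linarith)).trans hr
  refine ⟨_, inter_mem_nhdsWithin _
    (Metric.ball_mem_nhds x (by positivity : 0 < r / 4)), ?_⟩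
  have h0 := ae_cutoffLaplacian_eq_zero hΩ hq hf
  rw [ae_restrict_iff' hΩ.measurableSet, ae_iff] at h0
  refine measure_mono_null ?_ h0
  rintro y hy hy'
  refine hy.1 fun hyΩ hyw ↦ ?_
  have h1 : ∀ᶠ z in 𝓝 y, f z = 1 := f.eventuallyEq_one_of_mem_ball hy.2
  have h2 : ∀ᶠ z in 𝓝 y, fderiv ℝ f z = 0 := by
    filter_upwards [h1.eventually_nhds] with z hz
    have : (f : EuclideanSpace ℝ (Fin n) → ℝ) =ᶠ[𝓝 z] fun _ ↦ (1 : ℝ) := hz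
    rw [this.fderiv_eq, fderiv_fun_const, Pi.zero_apply]
  have h3 : ∀ m, fderiv ℝ (fun z ↦ fderiv ℝ f z m) y = 0 := fun m ↦ by
    have : (fun z ↦ fderiv ℝ f z m) =ᶠ[𝓝 y] fun _ ↦ (0 : ℝ) := by
      filter_upwards [h2] with z hz
      rw [hz, _root_.zero_apply]
    rw [this.fderiv_eq, fderiv_fun_const, Pi.zero_apply]
  simpa [cutoffLaplacian, h1.self_of_nhds, h2.self_of_nhds, h3] using hy' hyΩ hyw

/-! ### Order arguments: the control is an L² function between its bounds -/

theorem exists_isTestFunction_eq_one (hΩ : IsOpen Ω) {K : Set (EuclideanSpace ℝ (Fin n))}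
    (hK : IsCompact K) (hKΩ : K ⊆ Ω) :
    ∃ χ : EuclideanSpace ℝ (Fin n) → ℝ, IsTestFunction Ω χ ∧ (∀ x, 0 ≤ χ x) ∧
      ∀ x ∈ K, χ x = 1 := by
  obtain ⟨K', hK', hKK', hK'Ω⟩ := exists_compact_between hK hΩ hKΩ
  obtain ⟨χ, h1, h2, h3, h4⟩ := exists_contMDiff_support_eq_eq_one_iff
    (modelWithCornersSelf ℝ (EuclideanSpace ℝ (Fin n))) (n := (⊤ : ℕ∞))
    (isOpen_interior (s := K')) hK.isClosed hKK'
  have hsub : tsupport χ ⊆ K' := by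
    rw [tsupport, h3]
    exact (closure_mono interior_subset).trans hK'.isClosed.closure_subset
  refine ⟨χ, ⟨h1.contDiff, hK'.of_isClosed_subset (isClosed_tsupport χ) hsub,
    hsub.trans hK'Ω⟩, fun x ↦ (h2 (Set.mem_range_self x)).1, fun x hx ↦ (h4 x).mp hx⟩

/-- A smooth substitute for `|φ|`: `√(φ² + δ²) - δ` is supported in the support of `φ` but lies
below `|φ|`. Adding `δχ`, with `χ = 1` on that support, restores the majorant at an error of at most
`δχ`. -/
theorem IsTestFunction.exists_abs_le (hΩ : IsOpen Ω) {φ : EuclideanSpace ℝ (Fin n) → ℝ}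
    (hφ : IsTestFunction Ω φ) {ε : ℝ} (hε : 0 < ε) :
    ∃ (ψ : EuclideanSpace ℝ (Fin n) → ℝ) (hψ : IsTestFunction Ω ψ), (∀ x, |φ x| ≤ ψ x) ∧
      ‖hψ.memLp.toLp ψ - |hφ.memLp.toLp φ|‖ ≤ ε := by
  obtain ⟨χ, hχ, hχ0, hχ1⟩ := exists_isTestFunction_eq_one hΩ hφ.compact hφ.subset
  set δ : ℝ := ε / (‖hχ.memLp.toLp χ‖ + 1) with hδ
  have hδ0 : 0 < δ := by positivity
  have hz : ∀ x, x ∉ tsupport φ → φ x = 0 := fun x hx ↦ image_eq_zero_of_notMem_tsupport hx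
  have hs : Real.sqrt (0 ^ 2 + δ ^ 2) - δ = 0 := by
    rw [zero_pow two_ne_zero, zero_add, Real.sqrt_sq hδ0.le, sub_self]
  have hsq : IsTestFunction Ω fun x ↦ Real.sqrt (φ x ^ 2 + δ ^ 2) - δ := by
    have hsub : tsupport (fun x ↦ Real.sqrt (φ x ^ 2 + δ ^ 2) - δ) ⊆ tsupport φ := by
      refine closure_mono fun x hx h0 ↦ hx ?_
      simp only
      rw [h0, hs]
    refine ⟨(((hφ.smooth.pow 2).add contDiff_const).sqrt fun x ↦ by positivity).sub
      contDiff_const, hφ.compact.of_isClosed_subset (isClosed_tsupport _) hsub,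
      hsub.trans hφ.subset⟩
  have hψ : IsTestFunction Ω fun x ↦ (Real.sqrt (φ x ^ 2 + δ ^ 2) - δ) + χ x * δ := by
    have h2 := hχ.mul (contDiff_const (c := δ))
    exact ⟨hsq.smooth.add h2.smooth, hsq.compact.add h2.compact,
      (tsupport_add _ _).trans (Set.union_subset hsq.subset h2.subset)⟩
  have hle : ∀ x, Real.sqrt (φ x ^ 2 + δ ^ 2) - δ ≤ |φ x| := fun x ↦ by
    rw [sub_le_iff_le_add, Real.sqrt_le_left (by positivity), add_sq, sq_abs]
    nlinarith [mul_nonneg (abs_nonneg (φ x)) hδ0.le]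
  have hge : ∀ x, |φ x| ≤ (Real.sqrt (φ x ^ 2 + δ ^ 2) - δ) + χ x * δ := fun x ↦ by
    by_cases hx : x ∈ tsupport φ
    · rw [hχ1 x hx, one_mul, sub_add_cancel]
      exact Real.abs_le_sqrt (by nlinarith [sq_nonneg δ])
    · rw [hz x hx, hs, abs_zero, zero_add]
      exact mul_nonneg (hχ0 x) hδ0.le
  refine ⟨_, hψ, hge, ?_⟩
  have hb : ‖hψ.memLp.toLp _ - |hφ.memLp.toLp φ|‖ ≤ δ * ‖hχ.memLp.toLp χ‖ := by
    refine Lp.norm_le_mul_norm_of_ae_le_mul ?_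
    filter_upwards [Lp.coeFn_sub (hψ.memLp.toLp _) |hφ.memLp.toLp φ|,
      Lp.coeFn_abs (hφ.memLp.toLp φ), hψ.memLp.coeFn_toLp, hφ.memLp.coeFn_toLp,
      hχ.memLp.coeFn_toLp] with x h1 h2 h3 h4 h5
    rw [h1, Pi.sub_apply, h2, h3, h4, h5, Real.norm_of_nonneg (sub_nonneg.mpr (hge x)),
      Real.norm_of_nonneg (hχ0 x)]
    linarith [hle x]
  refine hb.trans ?_
  rw [hδ, div_mul_eq_mul_div, div_le_iff₀ (by positivity)]
  nlinarith

/-- The bound makes `f` factor through the range of `T`, continuously for the norm of `K`.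
Hahn–Banach extends the factor and Riesz represents it. -/
theorem exists_forall_eq_inner {H K : Type*} [NormedAddCommGroup H] [InnerProductSpace ℝ H]
    [NormedAddCommGroup K] [InnerProductSpace ℝ K] [CompleteSpace K] (T : H →L[ℝ] K)
    (f : H →L[ℝ] ℝ) {C : ℝ} (hf : ∀ v, |f v| ≤ C * ‖T v‖) : ∃ z : K, ∀ v, f v = ⟪z, T v⟫ := by
  have hker : T.toLinearMap.ker ≤ f.toLinearMap.ker := fun v hv ↦ by
    have h1 : T v = 0 := hv
    have h2 := hf v
    rw [h1, norm_zero, mul_zero] at h2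
    exact abs_nonpos_iff.mp h2
  set g : T.toLinearMap.range →ₗ[ℝ] ℝ :=
    (T.toLinearMap.ker.liftQ f.toLinearMap hker) ∘ₗ T.toLinearMap.quotKerEquivRange.symm
    with hg
  have hgT : ∀ v, g ⟨T v, LinearMap.mem_range_self T.toLinearMap v⟩ = f v := fun v ↦ by
    have : T.toLinearMap.quotKerEquivRange.symm
        ⟨T v, LinearMap.mem_range_self T.toLinearMap v⟩ = T.toLinearMap.ker.mkQ v :=
      T.toLinearMap.quotKerEquivRange_symm_apply_image v _
    rw [hg, LinearMap.comp_apply, LinearEquiv.coe_coe, this]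
    rfl
  obtain ⟨F, hF, -⟩ := exists_extension_norm_eq (𝕜 := ℝ) _ (g.mkContinuous C (by
    rintro ⟨_, v, rfl⟩
    exact (congrArg abs (hgT v)).le.trans (hf v)))
  refine ⟨(InnerProductSpace.toDual ℝ K).symm F, fun v ↦ ?_⟩
  rw [InnerProductSpace.toDual_symm_apply, ← hgT v]
  exact (hF ⟨T v, LinearMap.mem_range_self T.toLinearMap v⟩).symm

/-- With `f` the positive functional and `ψ ≥ |φ|` a smooth majorant, `|f φ| ≤ f ψ ≤ ‖fp - fm‖ ‖ψ‖`.
Letting `ψ` approach `|φ|` in L² gives the bound needed for Riesz. -/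
theorem exists_eq_inner_of_mem_Kc (hΩ : IsOpen Ω) {fm fp : L2 Ω} {u : H10 Ω}
    (hu : u ∈ Kc Ω fm fp) : ∃ z : L2 Ω, ∀ v, ⟪grad Ω u, grad Ω v⟫ = ⟪z, toL2 Ω v⟫ := by
  set f : H10 Ω →L[ℝ] ℝ := (innerSL ℝ (grad Ω u)).comp (grad Ω) -
    (innerSL ℝ fm).comp (toL2 Ω) with hf
  have hfv : ∀ v, f v = ⟪grad Ω u, grad Ω v⟫ - ⟪fm, toL2 Ω v⟫ := fun v ↦ rfl
  obtain ⟨z, hz⟩ := exists_forall_eq_inner (toL2 Ω) f (C := ‖fp - fm‖) <| by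
    refine H10.induction (isClosed_le f.continuous.abs (by fun_prop)) fun φ hφ ↦ ?_
    have key : ∀ ε : ℝ, 0 < ε →
        |f hφ.toH10| ≤ ‖fp - fm‖ * (‖toL2 Ω hφ.toH10‖ + ε) := by
      intro ε hε
      obtain ⟨ψ, hψ, h1, h2⟩ := hφ.exists_abs_le hΩ hε
      have hcoe := fun x ↦ abs_le.mp (h1 x)
      have p1 : ∀ᵐ x ∂(volume.restrict Ω), 0 ≤ toL2 Ω (hψ.toH10 - hφ.toH10) x := by
        rw [map_sub]
        filter_upwards [Lp.coeFn_sub (toL2 Ω hψ.toH10) (toL2 Ω hφ.toH10),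
          hψ.memLp.coeFn_toLp, hφ.memLp.coeFn_toLp] with x a1 a2 a3
        rw [a1, Pi.sub_apply, hψ.toL2_toH10, hφ.toL2_toH10, a2, a3]
        linarith [(hcoe x).2]
      have p2 : ∀ᵐ x ∂(volume.restrict Ω), 0 ≤ toL2 Ω (hψ.toH10 + hφ.toH10) x := by
        rw [map_add]
        filter_upwards [Lp.coeFn_add (toL2 Ω hψ.toH10) (toL2 Ω hφ.toH10),
          hψ.memLp.coeFn_toLp, hφ.memLp.coeFn_toLp] with x a1 a2 a3
        rw [a1, Pi.add_apply, hψ.toL2_toH10, hφ.toL2_toH10, a2, a3]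
        linarith [(hcoe x).1]
      have p3 : ∀ᵐ x ∂(volume.restrict Ω), 0 ≤ toL2 Ω hψ.toH10 x := by
        filter_upwards [hψ.memLp.coeFn_toLp] with x a2
        rw [hψ.toL2_toH10, a2]
        exact (abs_nonneg _).trans (h1 x)
      have q1 : 0 ≤ f (hψ.toH10 - hφ.toH10) := sub_nonneg.mpr (hu _ p1).1
      have q2 : 0 ≤ f (hψ.toH10 + hφ.toH10) := sub_nonneg.mpr (hu _ p2).1
      have q3 : f hψ.toH10 ≤ ⟪fp - fm, toL2 Ω hψ.toH10⟫ := by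
        rw [hfv, inner_sub_left]
        exact sub_le_sub_right (hu _ p3).2 _
      rw [map_sub] at q1
      rw [map_add] at q2
      have q4 : ‖toL2 Ω hψ.toH10‖ ≤ ‖toL2 Ω hφ.toH10‖ + ε := by
        have := norm_le_norm_add_norm_sub' (toL2 Ω hψ.toH10) |toL2 Ω hφ.toH10|
        rw [norm_abs_eq_norm] at this
        exact this.trans (add_le_add_right h2 _)
      have q5 := (real_inner_le_norm (fp - fm) (toL2 Ω hψ.toH10)).trans
        (mul_le_mul_of_nonneg_left q4 (norm_nonneg _))
      exact abs_le.mpr ⟨by linarith, by linarith⟩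
    have hlim : Tendsto (fun ε : ℝ ↦ ‖fp - fm‖ * (‖toL2 Ω hφ.toH10‖ + ε)) (𝓝[>] 0)
        (𝓝 (‖fp - fm‖ * (‖toL2 Ω hφ.toH10‖ + 0))) :=
      ((continuous_const.mul (continuous_const.add continuous_id)).tendsto _).mono_left
        nhdsWithin_le_nhds
    rw [add_zero] at hlim
    exact ge_of_tendsto hlim (eventually_mem_nhdsWithin.mono fun ε hε ↦ key ε hε)
  refine ⟨z + fm, fun v ↦ ?_⟩
  rw [inner_add_left, ← hz, hfv, sub_add_cancel]

theorem denseRange_toL2 (hΩ : IsOpen Ω) : DenseRange (toL2 Ω) := by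
  have h : (toL2 Ω).toLinearMap.range.topologicalClosure = ⊤ := by
    rw [Submodule.topologicalClosure_eq_top_iff, Submodule.eq_bot_iff]
    intro g hg
    rw [Submodule.mem_orthogonal'] at hg
    have hloc : LocallyIntegrableOn (⇑g) Ω volume :=
      locallyIntegrableOn_of_locallyIntegrable_restrict
        ((Lp.memLp g).locallyIntegrable (by norm_num))
    have key := hΩ.ae_eq_zero_of_integral_contDiff_smul_eq_zero hloc fun φ h1 h2 h3 ↦ by
      have hφ : IsTestFunction Ω φ := ⟨h1, h2, h3⟩
      have h4 := hg (toL2 Ω hφ.toH10) (LinearMap.mem_range_self (toL2 Ω).toLinearMap hφ.toH10)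
      rw [hφ.toL2_toH10, inner_toLp_right] at h4
      rw [← setIntegral_eq_integral_of_forall_compl_eq_zero (s := Ω)
        (fun x hx ↦ by rw [hφ.eq_zero_of_notMem hx, zero_smul]), ← h4]
      refine integral_congr_ae (ae_of_all _ fun x ↦ ?_)
      simp [mul_comm]
    rw [← ae_restrict_iff' hΩ.measurableSet] at key
    refine Lp.ext ?_
    filter_upwards [key, Lp.coeFn_zero ℝ 2 (volume.restrict Ω)] with x h1 h2
    rw [h1, h2, Pi.zero_apply]
  exact Submodule.dense_iff_topologicalClosure_eq_top.mpr h

/-- The hypothesis tests only nonnegative elements of `H¹₀(Ω)`. Density reduces `y` to a test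
function, and its smooth majorants then approximate `|y|`. -/
theorem inner_abs_nonneg (hΩ : IsOpen Ω) {g : L2 Ω}
    (h : ∀ v : H10 Ω, (∀ᵐ x ∂(volume.restrict Ω), 0 ≤ toL2 Ω v x) → 0 ≤ ⟪g, toL2 Ω v⟫)
    (y : L2 Ω) : 0 ≤ ⟪g, |y|⟫ := by
  have hc : Continuous fun y : L2 Ω ↦ ⟪g, |y|⟫ :=
    (innerSL ℝ g).continuous.comp (continuous_id.sup continuous_neg)
  refine (denseRange_toL2 hΩ).induction_on (p := fun y ↦ 0 ≤ ⟪g, |y|⟫) y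
    (isClosed_le continuous_const hc) ?_
  refine H10.induction (isClosed_le continuous_const (hc.comp (toL2 Ω).continuous)) fun φ hφ ↦ ?_
  have key : ∀ ε : ℝ, 0 < ε → 0 ≤ ⟪g, |toL2 Ω hφ.toH10|⟫ + ‖g‖ * ε := by
    intro ε hε
    obtain ⟨ψ, hψ, h1, h2⟩ := hφ.exists_abs_le hΩ hε
    have p1 : 0 ≤ ⟪g, toL2 Ω hψ.toH10⟫ := by
      refine h _ ?_
      filter_upwards [hψ.memLp.coeFn_toLp] with x a
      rw [hψ.toL2_toH10, a]
      exact (abs_nonneg _).trans (h1 x)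
    have p2 := (real_inner_le_norm g (toL2 Ω hψ.toH10 - |toL2 Ω hφ.toH10|)).trans
      (mul_le_mul_of_nonneg_left h2 (norm_nonneg g))
    rw [inner_sub_right] at p2
    linarith
  have hlim : Tendsto (fun ε : ℝ ↦ ⟪g, |toL2 Ω hφ.toH10|⟫ + ‖g‖ * ε) (𝓝[>] 0)
      (𝓝 (⟪g, |toL2 Ω hφ.toH10|⟫ + ‖g‖ * 0)) :=
    ((continuous_const.add (continuous_const.mul continuous_id)).tendsto _).mono_left
      nhdsWithin_le_nhds
  rw [mul_zero, add_zero] at hlim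
  exact ge_of_tendsto hlim (eventually_mem_nhdsWithin.mono fun ε hε ↦ key ε hε)

theorem ae_nonneg_of_inner_nonneg (hΩ : IsOpen Ω) {g : L2 Ω}
    (h : ∀ v : H10 Ω, (∀ᵐ x ∂(volume.restrict Ω), 0 ≤ toL2 Ω v x) → 0 ≤ ⟪g, toL2 Ω v⟫) :
    ∀ᵐ x ∂(volume.restrict Ω), 0 ≤ g x := by
  -- Testing with twice the negative part of `g` gives `‖g‖² ≤ ⟨g, |g|⟩`, hence `‖|g| - g‖² ≤ 0`.
  have h1 := inner_abs_nonneg hΩ h (|g| - g)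
  rw [abs_of_nonneg (sub_nonneg.mpr (le_abs_self g)), inner_sub_right,
    real_inner_self_eq_norm_sq] at h1
  have h2 : ‖|g| - g‖ ^ 2 ≤ 0 := by
    rw [norm_sub_sq_real, norm_abs_eq_norm, real_inner_comm]
    linarith
  have h3 : |g| = g := by
    rw [← sub_eq_zero, ← norm_eq_zero]
    exact pow_eq_zero_iff two_ne_zero |>.mp (le_antisymm h2 (sq_nonneg _))
  filter_upwards [Lp.coeFn_abs g] with x hx
  rw [h3] at hx
  rw [hx]
  exact abs_nonneg _

theorem inner_le_inner_of_ae_le {f g y : L2 Ω} (hfg : ∀ᵐ x ∂(volume.restrict Ω), f x ≤ g x)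
    (hy : ∀ᵐ x ∂(volume.restrict Ω), 0 ≤ y x) : ⟪f, y⟫ ≤ ⟪g, y⟫ := by
  rw [L2.inner_def, L2.inner_def]
  refine integral_mono_ae (L2.integrable_inner f y) (L2.integrable_inner g y) ?_
  filter_upwards [hfg, hy] with x h1 h2
  simpa using mul_le_mul_of_nonneg_left h1 h2

theorem ae_mul_eq_zero_of_inner_nonneg {d w : L2 Ω}
    (h : ∀ᵐ x ∂(volume.restrict Ω), d x * w x ≤ 0) (h0 : 0 ≤ ⟪d, w⟫) :
    ∀ᵐ x ∂(volume.restrict Ω), d x * w x = 0 := by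
  have hi : Integrable (fun x ↦ -(d x * w x)) (volume.restrict Ω) :=
    ((Lp.memLp d).integrable_mul (Lp.memLp w)).neg
  have h1 : ⟪d, w⟫ = ∫ x in Ω, d x * w x := by
    rw [L2.inner_def]
    simp [mul_comm]
  have hnn : 0 ≤ᵐ[volume.restrict Ω] fun x ↦ -(d x * w x) := by
    filter_upwards [h] with x hx
    exact neg_nonneg.mpr hx
  have h2 : ∫ x in Ω, -(d x * w x) = 0 := by
    refine le_antisymm ?_ (integral_nonneg_of_ae hnn)
    rw [integral_neg, ← h1]
    exact neg_nonpos.mpr h0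
  filter_upwards [(integral_eq_zero_iff_of_nonneg_ae hnn hi).mp h2] with x hx
  exact neg_eq_zero.mp hx

/-! ### Optimality conditions and the estimate of the state error -/

section Control

variable {fm fp z : L2 Ω} {u : H10 Ω}

theorem ae_le_and_le_of_mem_Kc (hΩ : IsOpen Ω) (hu : u ∈ Kc Ω fm fp)
    (hz : ∀ v, ⟪grad Ω u, grad Ω v⟫ = ⟪z, toL2 Ω v⟫) :
    ∀ᵐ x ∂(volume.restrict Ω), fm x ≤ z x ∧ z x ≤ fp x := by
  have h1 := ae_nonneg_of_inner_nonneg hΩ (g := z - fm) fun v hv ↦ by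
    rw [inner_sub_left, ← hz]
    exact sub_nonneg.mpr (hu v hv).1
  have h2 := ae_nonneg_of_inner_nonneg hΩ (g := fp - z) fun v hv ↦ by
    rw [inner_sub_left, ← hz]
    exact sub_nonneg.mpr (hu v hv).2
  filter_upwards [h1, h2, Lp.coeFn_sub z fm, Lp.coeFn_sub fp z] with x a1 a2 a3 a4
  rw [a3, Pi.sub_apply] at a1
  rw [a4, Pi.sub_apply] at a2
  exact ⟨sub_nonneg.mp a1, sub_nonneg.mp a2⟩

/-- Writing `y = -Δv` with `v ∈ K_c`, the adjoint equation tested with `v - u` identifies this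
pairing with the difference of the two sides of the variational inequality. -/
theorem inner_sub_nonneg_of_solvesVI (hn : 1 ≤ n) (hΩb : Bornology.IsBounded Ω) {ρ : ℝ}
    {ubar : L2 Ω} (hu : SolvesVI Ω fm fp ρ ubar u) {w : H10 Ω}
    (hw : SolvesAdjoint Ω ρ ubar u w) (hz : ∀ v, ⟪grad Ω u, grad Ω v⟫ = ⟪z, toL2 Ω v⟫)
    {y : L2 Ω} (hy : ∀ᵐ x ∂(volume.restrict Ω), fm x ≤ y x ∧ y x ≤ fp x) :
    0 ≤ ⟪y - z, toL2 Ω w⟫ := by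
  obtain ⟨v, hv⟩ := exists_neg_laplacian_eq hn hΩb y
  have hvK : v ∈ Kc Ω fm fp := fun s hs ↦ by
    rw [hv]
    exact ⟨inner_le_inner_of_ae_le (hy.mono fun _ h ↦ h.1) hs,
      inner_le_inner_of_ae_le (hy.mono fun _ h ↦ h.2) hs⟩
  have h1 := hu.2 v hvK
  have h2 := hw (v - u)
  rw [inner_sub_left, ← hv, ← hz, ← inner_sub_left, ← map_sub, real_inner_comm, h2,
    inner_sub_left]
  linarith

/-- The competitor equals `f` on `S` and `z` elsewhere. Its pairing integrates a nonpositive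
function to a nonnegative value, so the integrand vanishes. -/
theorem ae_mul_eq_zero_of_forall_inner_sub_nonneg {w f : L2 Ω}
    (hz : ∀ᵐ x ∂(volume.restrict Ω), fm x ≤ z x ∧ z x ≤ fp x)
    (hf : ∀ᵐ x ∂(volume.restrict Ω), fm x ≤ f x ∧ f x ≤ fp x)
    (h : ∀ y : L2 Ω, (∀ᵐ x ∂(volume.restrict Ω), fm x ≤ y x ∧ y x ≤ fp x) → 0 ≤ ⟪y - z, w⟫)
    {S : Set (EuclideanSpace ℝ (Fin n))} (hS : MeasurableSet S)
    (hneg : ∀ᵐ x ∂(volume.restrict Ω), x ∈ S → (f x - z x) * w x ≤ 0) :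
    ∀ᵐ x ∂(volume.restrict Ω), x ∈ S → (f x - z x) * w x = 0 := by
  have hd : MemLp (S.indicator ⇑(f - z)) 2 (volume.restrict Ω) := (Lp.memLp (f - z)).indicator hS
  have hdx : ∀ᵐ x ∂(volume.restrict Ω), (x ∈ S → hd.toLp _ x = f x - z x) ∧
      (x ∉ S → hd.toLp _ x = 0) := by
    filter_upwards [hd.coeFn_toLp, Lp.coeFn_sub f z] with x h1 h2
    rw [h1]
    refine ⟨fun hx ↦ ?_, fun hx ↦ Set.indicator_of_notMem hx _⟩
    rw [Set.indicator_of_mem hx, h2, Pi.sub_apply]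
  have h1 : 0 ≤ ⟪hd.toLp _, w⟫ := by
    have h2 := h (z + hd.toLp _) ?_
    · rwa [add_sub_cancel_left] at h2
    · filter_upwards [Lp.coeFn_add z (hd.toLp _), hdx, hz, hf] with x a1 a2 a3 a4
      rw [a1, Pi.add_apply]
      by_cases hx : x ∈ S
      · rw [a2.1 hx, add_sub_cancel]
        exact a4
      · rw [a2.2 hx, add_zero]
        exact a3
  have h2 := ae_mul_eq_zero_of_inner_nonneg ?_ h1
  · filter_upwards [h2, hdx] with x a1 a2 hx
    rwa [a2.1 hx] at a1
  · filter_upwards [hneg, hdx] with x a1 a2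
    by_cases hx : x ∈ S
    · rw [a2.1 hx]
      exact a1 hx
    · rw [a2.2 hx, zero_mul]

/-- Switching the control to `fp` where `w < 0` and to `fm` where `w > 0` shows that `z` already
equals that bound there. -/
theorem ae_eq_zero_of_notMem_activeSet (hΩ : IsOpen Ω) {w : L2 Ω}
    (hz : ∀ᵐ x ∂(volume.restrict Ω), fm x ≤ z x ∧ z x ≤ fp x)
    (h : ∀ y : L2 Ω, (∀ᵐ x ∂(volume.restrict Ω), fm x ≤ y x ∧ y x ≤ fp x) →
      0 ≤ ⟪y - z, w⟫) :
    ∀ᵐ x ∂(volume.restrict Ω), x ∉ activeSet Ω z fm ∪ activeSet Ω z fp → w x = 0 := by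
  have hwm : Measurable w := (Lp.stronglyMeasurable w).measurable
  have h1 := ae_mul_eq_zero_of_forall_inner_sub_nonneg hz
    (hz.mono fun x hx ↦ ⟨hx.1.trans hx.2, le_rfl⟩) h (S := {x | w x < 0})
    (measurableSet_lt hwm measurable_const)
    (hz.mono fun x hx hxS ↦ mul_nonpos_of_nonneg_of_nonpos (sub_nonneg.mpr hx.2) (le_of_lt hxS))
  have h2 := ae_mul_eq_zero_of_forall_inner_sub_nonneg hz
    (hz.mono fun x hx ↦ ⟨le_rfl, hx.1.trans hx.2⟩) h (S := {x | 0 < w x})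
    (measurableSet_lt measurable_const hwm)
    (hz.mono fun x hx hxS ↦ mul_nonpos_of_nonpos_of_nonneg (sub_nonpos.mpr hx.1) (le_of_lt hxS))
  filter_upwards [h1, h2, ae_restrict_mem hΩ.measurableSet] with x a1 a2 hx hxA
  rcases lt_trichotomy (w x) 0 with hlt | heq | hgt
  · have := (mul_eq_zero.mp (a1 hlt)).resolve_right hlt.ne
    exact (hxA (Or.inr ⟨hx, (sub_eq_zero.mp this).symm⟩)).elim
  · exact heq
  · have := (mul_eq_zero.mp (a2 hgt)).resolve_right hgt.ne'
    exact (hxA (Or.inl ⟨hx, (sub_eq_zero.mp this).symm⟩)).elim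

/-- With `v = ubar` the inequality gives `‖ubar - u‖² + ρ‖∇(ubar - u)‖² ≤ -ρ⟨qbar, ubar - u⟩`.
Dropping the gradient term and applying Cauchy–Schwarz finishes. -/
theorem norm_sub_le_of_solvesVI {ρ : ℝ} (hρ : 0 < ρ) {ubar : H10 Ω}
    (hubar : ubar ∈ Kc Ω fm fp) (hu : SolvesVI Ω fm fp ρ (toL2 Ω ubar) u) {qbar : L2 Ω}
    (hq : ∀ v, -⟪grad Ω ubar, grad Ω v⟫ = ⟪qbar, toL2 Ω v⟫) :
    ‖toL2 Ω ubar - toL2 Ω u‖ ≤ ρ * ‖qbar‖ := by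
  have h1 := hu.2 ubar hubar
  rw [← sub_nonneg, ← sub_sub_cancel (grad Ω ubar) (grad Ω u), ← map_sub, inner_sub_left,
    real_inner_self_eq_norm_sq] at h1
  have h2 := hq (ubar - u)
  have h3 : ‖toL2 Ω (ubar - u)‖ ^ 2 =
      ⟪toL2 Ω ubar, toL2 Ω (ubar - u)⟫ - ⟪toL2 Ω u, toL2 Ω (ubar - u)⟫ := by
    rw [← inner_sub_left, ← map_sub, real_inner_self_eq_norm_sq]
  have h4 := neg_le_of_abs_le (abs_real_inner_le_norm qbar (toL2 Ω (ubar - u)))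
  rw [← map_sub]
  have h5 : ‖toL2 Ω (ubar - u)‖ * ‖toL2 Ω (ubar - u)‖ ≤
      ρ * ‖qbar‖ * ‖toL2 Ω (ubar - u)‖ := by
    nlinarith [mul_nonneg hρ.le (sq_nonneg ‖grad Ω (ubar - u)‖),
      mul_le_mul_of_nonneg_left h4 hρ.le]
  rcases (norm_nonneg (toL2 Ω (ubar - u))).eq_or_lt with h0 | h0
  · rw [← h0]
    positivity
  · exact le_of_mul_le_mul_right h5 h0

end Control

end EnergyControl

/-! ### Assembly of the theorem -/

theorem mainTheorem7 {n : ℕ} (hn : 1 ≤ n) (Ω : Set (EuclideanSpace ℝ (Fin n)))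
    (hΩ : IsOpen Ω) (hΩb : Bornology.IsBounded Ω)
    (ρ : ℝ) (hρ : 0 < ρ) (fm fp : EnergyControl.L2 Ω)
    (ubar : EnergyControl.H10 Ω)
    (hubar : ubar ∈ EnergyControl.Kc Ω fm fp ∩ EnergyControl.H1Delta Ω)
    (u : EnergyControl.H10 Ω)
    (hu : EnergyControl.SolvesVI Ω fm fp ρ (EnergyControl.toL2 Ω ubar) u)
    (w : EnergyControl.H10 Ω)
    (hw : EnergyControl.SolvesAdjoint Ω ρ (EnergyControl.toL2 Ω ubar) u w) :
    (∃ z : EnergyControl.L2 Ω, -EnergyControl.laplacian Ω u = EnergyControl.ofL2 Ω z) ∧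
    (∃ q : EnergyControl.L2 Ω, EnergyControl.laplacian Ω w = EnergyControl.ofL2 Ω q) ∧
    ∀ z qbar : EnergyControl.L2 Ω,
      -EnergyControl.laplacian Ω u = EnergyControl.ofL2 Ω z →
      EnergyControl.laplacian Ω ubar = EnergyControl.ofL2 Ω qbar →
      (∀ᵐ x ∂(MeasureTheory.volume.restrict Ω),
        x ∉ EnergyControl.activeSet Ω z fm ∪ EnergyControl.activeSet Ω z fp →
          EnergyControl.toL2 Ω w x = 0) ∧
      MeasureTheory.eLpNorm z 2 (MeasureTheory.volume.restrict
          (Ω \ (EnergyControl.activeSet Ω z fm ∪ EnergyControl.activeSet Ω z fp))) ≤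
        MeasureTheory.eLpNorm qbar 2 (MeasureTheory.volume.restrict Ω) := by

  have hzn : ∀ z : EnergyControl.L2 Ω, -EnergyControl.laplacian Ω u = EnergyControl.ofL2 Ω z →
      ∀ v, ⟪EnergyControl.grad Ω u, EnergyControl.grad Ω v⟫ = ⟪z, EnergyControl.toL2 Ω v⟫ :=
    fun z hz v ↦ by
      have h : - -⟪EnergyControl.grad Ω u, EnergyControl.grad Ω v⟫ =
        ⟪z, EnergyControl.toL2 Ω v⟫ := DFunLike.congr_fun hz v
      rwa [neg_neg] at h
  have hwq : ∀ z : EnergyControl.L2 Ω, -EnergyControl.laplacian Ω u = EnergyControl.ofL2 Ω z →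
      EnergyControl.laplacian Ω w = EnergyControl.ofL2 Ω
        (-(ρ • z + (EnergyControl.toL2 Ω u - EnergyControl.toL2 Ω ubar))) := fun z hz ↦ by
    ext v
    change -⟪EnergyControl.grad Ω w, EnergyControl.grad Ω v⟫ = ⟪_, EnergyControl.toL2 Ω v⟫
    rw [hw v, hzn z hz, inner_neg_left, inner_add_left, real_inner_smul_left]
  obtain ⟨z₀, hz₀⟩ := EnergyControl.exists_eq_inner_of_mem_Kc hΩ hu.1
  have hz₀' : -EnergyControl.laplacian Ω u = EnergyControl.ofL2 Ω z₀ := by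
    ext v
    change - -⟪EnergyControl.grad Ω u, EnergyControl.grad Ω v⟫ = ⟪z₀, EnergyControl.toL2 Ω v⟫
    rw [neg_neg, hz₀]
  refine ⟨⟨z₀, hz₀'⟩, ⟨_, hwq z₀ hz₀'⟩, fun z qbar hz hqbar ↦ ?_⟩
  have hw0 := EnergyControl.ae_eq_zero_of_notMem_activeSet hΩ
    (EnergyControl.ae_le_and_le_of_mem_Kc hΩ hu.1 (hzn z hz))
    fun y hy ↦ EnergyControl.inner_sub_nonneg_of_solvesVI hn hΩb hu hw (hzn z hz) hy
  refine ⟨hw0, ?_⟩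
  set N := Ω \ (EnergyControl.activeSet Ω z fm ∪ EnergyControl.activeSet Ω z fp) with hN
  set e := EnergyControl.toL2 Ω ubar - EnergyControl.toL2 Ω u with he
  have hact : ∀ f : EnergyControl.L2 Ω, MeasurableSet (EnergyControl.activeSet Ω z f) :=
    fun f ↦ hΩ.measurableSet.inter (measurableSet_eq_fun
      (Lp.stronglyMeasurable z).measurable (Lp.stronglyMeasurable f).measurable)
  have hNm : MeasurableSet N := hΩ.measurableSet.diff ((hact fm).union (hact fp))
  -- On `N` the adjoint state is zero, hence so is `Δw = e - ρ z`.
  have hze : z =ᵐ[volume.restrict N] ⇑(ρ⁻¹ • e) := by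
    have h1 : ∀ᵐ x ∂(volume.restrict Ω),
        x ∉ EnergyControl.activeSet Ω z fm ∪ EnergyControl.activeSet Ω z fp →
          z x = (ρ⁻¹ • e) x := by
      have hq : -(ρ • z + (EnergyControl.toL2 Ω u - EnergyControl.toL2 Ω ubar)) =
          e - ρ • z := by
        rw [he]
        abel
      have h2 := EnergyControl.ae_laplacian_eq_zero hΩ (hwq z hz)
      rw [hq] at h2
      filter_upwards [hw0, h2, Lp.coeFn_sub e (ρ • z), Lp.coeFn_smul ρ z,
        Lp.coeFn_smul ρ⁻¹ e] with x a1 a2 a3 a4 a5 hx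
      have a6 := a2 (a1 hx)
      rw [a3, Pi.sub_apply, a4, Pi.smul_apply, smul_eq_mul, sub_eq_zero] at a6
      rw [a5, Pi.smul_apply, smul_eq_mul, a6, inv_mul_cancel_left₀ hρ.ne']
    filter_upwards [ae_restrict_of_ae_restrict_of_subset Set.sdiff_subset h1,
      ae_restrict_mem hNm] with x hx hxN
    exact hx hxN.2
  rw [eLpNorm_congr_ae hze]
  -- Only now is `N` enlarged to `Ω`: the norm of `ρ⁻¹ • e` is controlled on all of `Ω`, whereas `z`
  -- equals it only on `N`.
  refine (eLpNorm_mono_measure _ (Measure.restrict_mono Set.sdiff_subset le_rfl)).trans ?_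
  rw [← Lp.enorm_def, ← Lp.enorm_def, enorm_le_iff_norm_le, norm_smul, norm_inv,
    Real.norm_of_nonneg hρ.le, inv_mul_le_iff₀ hρ]
  exact EnergyControl.norm_sub_le_of_solvesVI hρ hubar.1 hu fun v ↦ DFunLike.congr_fun hqbar v
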